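/- **Setting.** There are $K\ge 2$ arms and rounds $t=1,2,\dots$. The losses $\ell_t\in[0,1]^K$ are random vectors that do not react to the learner (oblivious environment). They follow the *stochastically constrained adversarial regime* with a unique best arm: there are constants $\Delta_{i,j}$ such that $\mathbb E[\ell_{t,i}-\ell_{t,j}\mid \ell_1,\dots,\ell_{t-1}]=\Delta_{i,j}$ almost surely for all $t,i,j$ (in particular this holds if $\ell_1,\ell_2,\dots$ are independent with $\mathbb E[\ell_{t,i}-\ell_{t,j}]=\Delta_{i,j}$; the means $\mathbb E[\ell_{t,i}]$ may fluctuate with $t$). The suboptimality gaps are $\Delta_i=\Delta_{i,1}-\min_j\Delta_{j,1}$, and $i^*$ is an arm with $\Delta_i>0$ for all $i\ne i^*$. **Algorithm (Tsallis-Switch).** Given switching costs $\lambda_n\ge 0$, put $a_n=\sum_{s=1}^n\bigl(\lambda_s+\sqrt{K/s}\bigr)$, $|B_n|=\max\bigl\{\bigl\lceil\sqrt{\lambda_na_n/K}\,\bigr\rceil,1\bigr\}$ and $\eta_n=\frac{2\sqrt{2K}}{3a_n}$, and divide the rounds into consecutive blocks $B_1,B_2,\dots$ of these lengths. In block $n$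 the learner draws an arm $I_n$ from $p_n=\arg\min_{p\in\Delta^{K-1}}\bigl\{\langle p,\tilde C_{n-1}\rangle-\sum_{i=1}^K\frac{4\sqrt{p_i}-2p_i}{\eta_n}\bigr\}$, where $\Delta^{K-1}$ is the probability simplex, plays it in all rounds of the block ($J_t=I_n$ for $t\in B_n$), observes $c_{n,I_n}=\sum_{t\in B_n}\ell_{t,I_n}$, and sets $\tilde C_n(i)=\tilde C_{n-1}(i)+\frac{c_{n,i}}{p_{n,i}}\mathbf 1[I_n=i]$, with $\tilde C_0=0$. For a horizon $T\ge 1$ let $N$ be the smallest integer with $\sum_{n=1}^N|B_n|\ge T$. The pseudo-regret with switching costs is $$R\bigl(T,(\lambda_n)_{n\ge1}\bigr)=\mathbb E\Bigl[\sum_{t=1}^T\ell_{t,J_t}\Bigr]-\min_i\mathbb E\Bigl[\sum_{t=1}^T\ell_{t,i}\Bigr]+\sum_{n=1}^N\lambda_n\Pr(I_n\ne I_{n-1}),$$ where the first block always counts as a switch. Let also $$\mathcal B_T=\sum_{n=1}^N\sum_{i\ne i^*}\frac{\bigl(11\lambda_n+\lambda_{n+1}+\frac{10\sqrt2}{\sqrt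 n}\bigr)^2}{4\Delta_i|B_n|}+\sum_{n=1}^{N_0}\frac{2\sqrt2\,\lambda_n}{\sqrt K}+4\sqrt{2N_0}+\lambda_1+2,$$ where in the first sum the last block is truncated so that $\sum_{n=1}^N|B_n|=T$, and, with the untruncated lengths, $N_0$ is the smallest $n\le N$ such that $\eta_m|B_m|\le\frac14$ for all $m\ge n$ ($N_0=N$ if there is none). **Statement.** Let $\lambda_n=n^\alpha$ for $n\ge 1$, with $\alpha>0$. There is a constant $C$ depending only on $\alpha$ such that for all $K\ge 2$, all such environments and all $T\ge 1$, both $R\bigl(T,(\lambda_n)_{n\ge1}\bigr)$ and $\mathcal B_T$ are at most $$C\sum_{i\ne i^*}\frac{K^{\frac{2\alpha+2}{2\alpha+3}}\,T^{\frac{2\alpha+1}{2\alpha+3}}+K^{\frac{2\alpha}{2\alpha+3}}\,T^{\frac{4\alpha}{2\alpha+3}}}{\Delta_i}.$$ If $\alpha<\frac32$, then for fixed $K$ and fixed gaps this bound is $o(T)$ as $T\to\infty$. -/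

import Mathlib

open MeasureTheory ProbabilityTheory Filter Asymptotics
open scoped BigOperators Topology

noncomputable section

namespace TsallisSwitch

/-! Rounds `t = 1, 2, …` and blocks `n = 1, 2, …` are numbered from one; the values of the sequences
at index `0` play no role. The arms are the elements of `Fin K`, the loss of arm `i` in round `t` is
`ℓ t ω i`, and `lam n` is the switching cost charged at the beginning of block `n`. -/

/-! ### Parameters of the algorithm -/

/-- `a_n = ∑_{s=1}^n (λ_s + √(K/s))`. -/
def scale (K : ℕ) (lam : ℕ → ℝ) (n : ℕ) : ℝ :=
  ∑ s ∈ Finset.Icc 1 n, (lam s + √((K : ℝ) / (s : ℝ)))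

/-- The (untruncated) block length `|B_n| = max {⌈√(λ_n a_n / K)⌉, 1}`. -/
def blockLen (K : ℕ) (lam : ℕ → ℝ) (n : ℕ) : ℕ :=
  max ⌈√(lam n * scale K lam n / (K : ℝ))⌉₊ 1

/-- The learning rate `η_n = 2 √(2K) / (3 a_n)`. -/
def learningRate (K : ℕ) (lam : ℕ → ℝ) (n : ℕ) : ℝ :=
  2 * √(2 * (K : ℝ)) / (3 * scale K lam n)

/-! ### Division of the rounds into blocks -/

/-- The last round of block `n`: `|B_1| + ⋯ + |B_n|`. -/
def blockEnd (len : ℕ → ℕ) (n : ℕ) : ℕ :=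
  ∑ m ∈ Finset.Icc 1 n, len m

/-- The index of the block that contains round `t`: the smallest `n` with `|B_1| + ⋯ + |B_n| ≥ t`.
For the time horizon `T`, `blockOf len T` is the number `N` of blocks that cover `T` rounds. -/
def blockOf (len : ℕ → ℕ) (t : ℕ) : ℕ :=
  sInf {n : ℕ | t ≤ blockEnd len n}

/-- The length of block `n ≤ N` when the last block is truncated so that `N` blocks sum up to `T`. -/
def truncatedLen (len : ℕ → ℕ) (T n : ℕ) : ℕ :=
  min (blockEnd len n) T - blockEnd len (n - 1)

/-- `c_{n,i}`, the cumulative loss of arm `i` over the block `n`. -/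
def blockLoss {K : ℕ} {Ω : Type*} (ℓ : ℕ → Ω → Fin K → ℝ) (len : ℕ → ℕ) (n : ℕ) (ω : Ω)
    (i : Fin K) : ℝ :=
  ∑ t ∈ Finset.Ioc (blockEnd len (n - 1)) (blockEnd len n), ℓ t ω i

/-! ### The algorithm -/

/-- The objective minimized by the sampling distribution:
`⟨p, C⟩ - ∑ i, (4 √p_i - 2 p_i) / η`. -/
def objective {K : ℕ} (η : ℝ) (C p : Fin K → ℝ) : ℝ :=
  (∑ i, p i * C i) - ∑ i, (4 * √(p i) - 2 * p i) / η

/-- `C̃_n(i)`, the cumulative importance-weighted loss of arm `i` after `n` blocks. -/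
def cumEstimate {K : ℕ} {Ω : Type*} (ℓ : ℕ → Ω → Fin K → ℝ) (len : ℕ → ℕ) (I : ℕ → Ω → Fin K)
    (p : ℕ → Ω → Fin K → ℝ) (n : ℕ) (ω : Ω) (i : Fin K) : ℝ :=
  ∑ m ∈ Finset.Icc 1 n, if I m ω = i then blockLoss ℓ len m ω i / p m ω i else 0

/-- The information generated by the losses of the rounds `1, …, t - 1`. -/
abbrev pastLosses {K : ℕ} {Ω : Type*} (ℓ : ℕ → Ω → Fin K → ℝ) (t : ℕ) : MeasurableSpace Ω :=
  ⨆ s ∈ Set.Ico 1 t, MeasurableSpace.comap (ℓ s) inferInstance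

/-- The information generated by the whole loss sequence and the actions of the blocks
`1, …, n - 1`. -/
abbrev lossesAndPastActions {K : ℕ} {Ω : Type*} (ℓ : ℕ → Ω → Fin K → ℝ) (I : ℕ → Ω → Fin K)
    (n : ℕ) : MeasurableSpace Ω :=
  (⨆ t ∈ Set.Ici 1, MeasurableSpace.comap (ℓ t) inferInstance) ⊔
    ⨆ m ∈ Set.Ico 1 n, MeasurableSpace.comap (I m) inferInstance

/-- `I n` (the arm played throughout block `n`) and `p n` (the distribution it is drawn from) form a
run of Tsallis-Switch with block lengths `len` and learning rates `η` on the losses `ℓ`. -/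
structure IsRun {K : ℕ} {Ω : Type*} [MeasurableSpace Ω] (P : Measure Ω)
    (ℓ : ℕ → Ω → Fin K → ℝ) (len : ℕ → ℕ) (η : ℕ → ℝ)
    (I : ℕ → Ω → Fin K) (p : ℕ → Ω → Fin K → ℝ) : Prop where
  measurable_action : ∀ n, 1 ≤ n → Measurable (I n)
  mem_simplex : ∀ n, 1 ≤ n → ∀ ω, p n ω ∈ stdSimplex ℝ (Fin K)
  isMinOn : ∀ n, 1 ≤ n → ∀ ω,
    IsMinOn (objective (η n) (cumEstimate ℓ len I p (n - 1) ω)) (stdSimplex ℝ (Fin K)) (p n ω)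
  /-- The arm of block `n` is drawn from `p n`. The losses are oblivious, so conditioning on all of
  them, future ones included, does not change the law of the draw. -/
  sample : ∀ n, 1 ≤ n → ∀ i : Fin K,
    P[Set.indicator {ω | I n ω = i} (fun _ => (1 : ℝ)) | lossesAndPastActions ℓ I n]
      =ᵐ[P] fun ω => p n ω i

/-! ### The environment -/

/-- The stochastically constrained adversarial regime: the losses lie in `[0, 1]`, and whatever the
losses of the earlier rounds were, the loss vector of round `t` is drawn from a distribution with
`E[ℓ_{t,i} - ℓ_{t,j}] = Δ_{i,j}`, where `Δ_{i,j}` is `gap i j` and does not depend on `t`. The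
means themselves may fluctuate. -/
structure IsStochConstrained {K : ℕ} {Ω : Type*} [MeasurableSpace Ω] (P : Measure Ω)
    (ℓ : ℕ → Ω → Fin K → ℝ) (gap : Fin K → Fin K → ℝ) : Prop where
  measurable_loss : ∀ t, 1 ≤ t → Measurable (ℓ t)
  mem_Icc : ∀ t, 1 ≤ t → ∀ ω i, ℓ t ω i ∈ Set.Icc (0 : ℝ) 1
  gap_eq : ∀ t, 1 ≤ t → ∀ i j,
    P[fun ω => ℓ t ω i - ℓ t ω j | pastLosses ℓ t] =ᵐ[P] fun _ => gap i j

/-- The suboptimality gap `Δ_i = Δ_{i,1} - min_j Δ_{j,1}`; the first arm is `0 : Fin K`. -/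
def subopt {K : ℕ} [NeZero K] (gap : Fin K → Fin K → ℝ) (i : Fin K) : ℝ :=
  gap i 0 - ⨅ j, gap j 0

/-! ### Regret -/

/-- The action of block `n`, with the convention that there is no arm in block `0`, so that there is
always a switch at the first block. -/
def actionOrNone {K : ℕ} {Ω : Type*} (I : ℕ → Ω → Fin K) (n : ℕ) (ω : Ω) : Option (Fin K) :=
  if n = 0 then none else some (I n ω)

/-- The pseudo-regret `E[∑_{t ≤ T} ℓ_{t,J_t}] - min_i E[∑_{t ≤ T} ℓ_{t,i}]`, where `J_t = I_n` for
the rounds `t` of block `n`. -/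
def pseudoRegret {K : ℕ} {Ω : Type*} [MeasurableSpace Ω] (P : Measure Ω)
    (ℓ : ℕ → Ω → Fin K → ℝ) (len : ℕ → ℕ) (I : ℕ → Ω → Fin K) (T : ℕ) : ℝ :=
  (∫ ω, ∑ t ∈ Finset.Icc 1 T, ℓ t ω (I (blockOf len t) ω) ∂P)
    - ⨅ i : Fin K, ∫ ω, ∑ t ∈ Finset.Icc 1 T, ℓ t ω i ∂P

/-- The cumulative switching cost `∑_{n=1}^N λ_n Pr(I_n ≠ I_{n-1})`. -/
def switchingCost {K : ℕ} {Ω : Type*} [MeasurableSpace Ω] (P : Measure Ω)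
    (len : ℕ → ℕ) (lam : ℕ → ℝ) (I : ℕ → Ω → Fin K) (T : ℕ) : ℝ :=
  ∑ n ∈ Finset.Icc 1 (blockOf len T),
    lam n * P.real {ω | actionOrNone I n ω ≠ actionOrNone I (n - 1) ω}

/-- The pseudo-regret with switching costs `R(T, (λ_n))`. -/
def switchingRegret {K : ℕ} {Ω : Type*} [MeasurableSpace Ω] (P : Measure Ω)
    (ℓ : ℕ → Ω → Fin K → ℝ) (len : ℕ → ℕ) (lam : ℕ → ℝ) (I : ℕ → Ω → Fin K) (T : ℕ) : ℝ :=
  pseudoRegret P ℓ len I T + switchingCost P len lam I T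

/-! ### The two bounds -/

/-- `N_0`: the smallest `n ≤ N` such that `η_m |B_m| ≤ 1/4` for all `m ≥ n`, and `N` if there is no
such `n`. -/
def burnIn (K : ℕ) (lam : ℕ → ℝ) (N : ℕ) : ℕ :=
  open Classical in
  let S : Set ℕ := {n | 1 ≤ n ∧ n ≤ N ∧
    ∀ m, n ≤ m → learningRate K lam m * (blockLen K lam m : ℝ) ≤ 1 / 4}
  if S.Nonempty then sInf S else N

/-- The regret bound of Tsallis-Switch for general switching costs in the stochastically constrained
adversarial regime with gaps `Δ` and best arm `best`:
`∑_{n ≤ N} ∑_{i ≠ i*} (11 λ_n + λ_{n+1} + 10√2/√n)² / (4 Δ_i |B_n|)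
  + ∑_{n ≤ N_0} 2√2 λ_n / √K + 4 √(2 N_0) + λ_1 + 2`. -/
def generalBound {K : ℕ} (lam : ℕ → ℝ) (Δ : Fin K → ℝ) (best : Fin K) (T : ℕ) : ℝ :=
  let len := blockLen K lam
  let N := blockOf len T
  let N₀ := burnIn K lam N
  (∑ n ∈ Finset.Icc 1 N, ∑ i ∈ Finset.univ.erase best,
      (11 * lam n + lam (n + 1) + 10 * √2 / √(n : ℝ)) ^ 2
        / (4 * Δ i * (truncatedLen len T n : ℝ)))
    + (∑ n ∈ Finset.Icc 1 N₀, 2 * √2 * lam n / √(K : ℝ))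
    + 4 * √(2 * (N₀ : ℝ)) + lam 1 + 2

/-- `∑_{i ≠ i*} (K^((2α+2)/(2α+3)) T^((2α+1)/(2α+3)) + K^(2α/(2α+3)) T^(4α/(2α+3))) / Δ_i`. -/
def powerBound {K : ℕ} (α : ℝ) (Δ : Fin K → ℝ) (best : Fin K) (T : ℕ) : ℝ :=
  ∑ i ∈ Finset.univ.erase best,
    ((K : ℝ) ^ ((2 * α + 2) / (2 * α + 3)) * (T : ℝ) ^ ((2 * α + 1) / (2 * α + 3))
      + (K : ℝ) ^ (2 * α / (2 * α + 3)) * (T : ℝ) ^ (4 * α / (2 * α + 3))) / Δ i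

end TsallisSwitch

end

open TsallisSwitch

/-! Let x_n be the expected sum of √p_{n,i} over i ≠ i*, and let G = ∑_n |B_n| ∑_i Δ_i E[p_{n,i}] be
the expected regret over the N - 1 blocks before the last one. Everything is compared with Q = ∑_n
λ_n x_n. Follow the regularized leader bounds G by a stability sum and a penalty sum (`ftrl_regret`,
`regret_blocks_le`), and η_n and |B_n| are tuned so that both have coefficients O(λ_n) in front of
x_n. A switch requires a suboptimal arm in one of two neighbouring blocks, so the switching cost is
O(Q) as well (`switchingCost_le`). Up to lower-order terms G ≤ 20 Q; writing the regret as 2G - G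
plus the switching cost bounds it by D Q - G with D depending on α only. Completing the square in
√p_{n,i} (`mul_meanRoot_sub_le`) then leaves a multiple of ∑_n ∑_{i ≠ i*} λ_n² / (Δ_i |B_n|).

For λ_n = n^α one has |B_n| ≥ n^{α+1/2} / √((α+1)K). Hence this sum is O(√K N^{α+1/2}) ∑ 1/Δ_i,
while N^{α+3/2} = O(√K T); eliminating N gives the first term of the bound. The last block is
charged its full length, which is of the same order. The second term is needed for 𝓑_T only: there
the last block may be truncated to a single round, and it then contributes λ_N² / Δ_i = N^{2α} /
Δ_i. The regret is thus bounded directly and not through 𝓑_T.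

The probabilistic point is that the environment fixes the mean of loss differences given past losses
only, whereas the regret involves the actions too. Since each draw has law p_n even given all
losses, the actions can be added to the conditioning one block at a time
(`condExp_loss_sub_pastInfo`). -/

/-! ### Minimizers of the regularized objective -/

/-- The Bregman divergence of `-4 √·`, summed over the coordinates. -/
noncomputable def bregman {K : ℕ} (q p : Fin K → ℝ) : ℝ :=
  ∑ i, 2 * (√(q i) - √(p i)) ^ 2 / √(p i)

theorem bregman_nonneg {K : ℕ} (q p : Fin K → ℝ) : 0 ≤ bregman q p :=
  Finset.sum_nonneg fun _ _ => by positivity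

theorem objective_eq {K : ℕ} (η : ℝ) (C p : Fin K → ℝ) :
    objective η C p = ∑ i, p i * C i - η⁻¹ * ∑ i, (4 * √(p i) - 2 * p i) := by
  rw [objective, Finset.mul_sum]
  congr 1
  exact Finset.sum_congr rfl fun i _ => by rw [div_eq_inv_mul]

theorem simplex_le_one {K : ℕ} {p : Fin K → ℝ} (hp : p ∈ stdSimplex ℝ (Fin K)) (i : Fin K) :
    p i ≤ 1 := by
  rw [← hp.2]
  exact Finset.single_le_sum (fun j _ => hp.1 j) (Finset.mem_univ i)

/-- Moving mass towards the coordinate `i` shows that minimizers stay away from the boundary. -/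
theorem minimizer_lower_bound {K : ℕ} (hK : 0 < K) {η B : ℝ} (hη : 0 < η) {C p : Fin K → ℝ}
    (hC : ∀ i j, C i - C j ≤ B) (hp : p ∈ stdSimplex ℝ (Fin K))
    (hmin : IsMinOn (objective η C) (stdSimplex ℝ (Fin K)) p) (i : Fin K) :
    1 ≤ 2 * (η * B / 4 + √K) * √(p i) := by
  have hB : 0 ≤ B := by simpa using hC i i
  have hK0 : (0 : ℝ) < K := by exact_mod_cast hK
  have hK1 : (1 : ℝ) ≤ K := by exact_mod_cast hK
  obtain ⟨j, hj⟩ : ∃ j, 1 / (K : ℝ) ≤ p j := by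
    by_contra! h
    have : Nonempty (Fin K) := ⟨i⟩
    have := Finset.sum_lt_sum_of_nonempty (s := Finset.univ) Finset.univ_nonempty
      (fun j _ => h j)
    rw [hp.2] at this
    simp only [Finset.sum_const, Finset.card_univ, Fintype.card_fin, nsmul_eq_mul] at this
    rw [mul_one_div_cancel hK0.ne'] at this
    exact lt_irrefl _ this
  have hpj : 0 < p j := lt_of_lt_of_le (by positivity) hj
  have hinv : 1 / √(p j) ≤ √K := by
    rw [div_le_iff₀ (Real.sqrt_pos.2 hpj), ← Real.sqrt_mul hK0.le]
    apply Real.one_le_sqrt.2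
    calc (1 : ℝ) = K * (1 / K) := by field_simp
      _ ≤ K * p j := by gcongr
  by_cases hij : i = j
  · subst hij
    have h1 : 1 ≤ √K * √(p i) := by
      rw [div_le_iff₀ (Real.sqrt_pos.2 hpj)] at hinv
      linarith
    have h2 : 0 ≤ η * B * √(p i) := by positivity
    nlinarith
  set M := η * B / 4 + √K with hM
  have hpi := hp.1 i
  -- Move mass ε from `j`, where p_j ≥ 1/K, to `i`. The linear part of the regularizer cancels; the
  -- loss at `j` costs at most ε√K in the root and the linear term at most εB, which bounds the gain
  -- ε / (√(p_i + ε) + √p_i) of the root at `i`.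
  have key : ∀ ε : ℝ, 0 < ε → ε ≤ p j → 1 ≤ M * (√(p i + ε) + √(p i)) := by
    intro ε hε hεj
    let q : Fin K → ℝ := Function.update (Function.update p i (p i + ε)) j (p j - ε)
    have hsum : ∀ f : Fin K → ℝ → ℝ, ∑ k, f k (q k)
        = ∑ k, f k (p k) + (f i (p i + ε) - f i (p i)) + (f j (p j - ε) - f j (p j)) := by
      intro f
      have : ∀ k, f k (q k) = f k (p k) + (if k = i then f i (p i + ε) - f i (p i) else 0)
          + (if k = j then f j (p j - ε) - f j (p j) else 0) := by
        intro k
        by_cases h1 : k = j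
        · subst h1
          simp [q, Ne.symm hij]
        · by_cases h2 : k = i
          · subst h2
            simp [q, h1]
          · simp [q, h1, h2]
      simp_rw [this, Finset.sum_add_distrib]
      simp
    have hq : q ∈ stdSimplex ℝ (Fin K) := by
      constructor
      · intro k
        by_cases h1 : k = j
        · subst h1; simp [q]; linarith
        · by_cases h2 : k = i
          · subst h2; simp [q, h1]; linarith
          · simp [q, h1, h2]; exact hp.1 k
      · rw [hsum (fun _ x => x), hp.2]; ring
    have hle : objective η C p ≤ objective η C q := hmin hq
    rw [objective_eq, objective_eq, hsum (fun k x => x * C k),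
      hsum (fun _ x => 4 * √x - 2 * x)] at hle
    have e1 : (√(p i + ε) - √(p i)) * (√(p i + ε) + √(p i)) = ε := by
      have h1 := Real.mul_self_sqrt (show 0 ≤ p i + ε by linarith)
      have h2 := Real.mul_self_sqrt hpi
      ring_nf; ring_nf at h1 h2; linarith
    have e2 : √(p j) - √(p j - ε) ≤ ε * √K := by
      have h1 := Real.mul_self_sqrt hpj.le
      have h2 := Real.mul_self_sqrt (show 0 ≤ p j - ε by linarith)
      have h3 := Real.sqrt_nonneg (p j - ε)
      have h4 : 0 < √(p j) := Real.sqrt_pos.2 hpj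
      have h5 : √(p j) - √(p j - ε) ≤ ε * (1 / √(p j)) := by
        rw [mul_one_div, le_div_iff₀ h4]
        have : √(p j - ε) ≤ √(p j) := Real.sqrt_le_sqrt (by linarith)
        nlinarith
      exact h5.trans (by gcongr)
    have e3 : 4 * (√(p i + ε) - √(p i)) ≤ 4 * (ε * √K) + η * (ε * B) := by
      have hηi : 0 < η⁻¹ := inv_pos.2 hη
      have h1 : η⁻¹ * (4 * (√(p i + ε) - √(p i)) - 4 * (√(p j) - √(p j - ε)))
          ≤ ε * (C i - C j) := by linarith
      have h2 : ε * (C i - C j) ≤ ε * B := by gcongr; exact hC i j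
      have h3 : η * (η⁻¹ * (4 * (√(p i + ε) - √(p i)) - 4 * (√(p j) - √(p j - ε))))
          ≤ η * (ε * B) :=
      mul_le_mul_of_nonneg_left (h1.trans h2) hη.le
      rw [mul_inv_cancel_left₀ hη.ne'] at h3
      linarith
    have e4 : √(p i + ε) - √(p i) ≤ ε * M := by rw [hM]; linarith
    have e5 : 0 ≤ √(p i + ε) + √(p i) := by positivity
    have e6 := mul_le_mul_of_nonneg_right e4 e5
    rw [e1] at e6
    by_contra! hcon
    have := mul_lt_mul_of_pos_left hcon hε
    linarith
  have hlim : Tendsto (fun ε : ℝ => M * (√(p i + ε) + √(p i))) (𝓝[>] 0)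
      (𝓝 (M * (√(p i + 0) + √(p i)))) := by
    apply Tendsto.mono_left _ nhdsWithin_le_nhds
    apply Continuous.tendsto
    fun_prop
  have := ge_of_tendsto hlim (b := 1) (by
    filter_upwards [Ioo_mem_nhdsGT hpj] with ε hε
    exact key ε hε.1 hε.2.le)
  rw [add_zero] at this
  linarith

theorem minimizer_pos {K : ℕ} {η : ℝ} (hη : 0 < η) {C p : Fin K → ℝ}
    (hp : p ∈ stdSimplex ℝ (Fin K))
    (hmin : IsMinOn (objective η C) (stdSimplex ℝ (Fin K)) p) (i : Fin K) : 0 < p i := by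
  have hK : 0 < K := i.pos
  have h := minimizer_lower_bound hK hη (B := 2 * ∑ k, |C k|) (fun i j => by
    have h1 := Finset.single_le_sum (fun j _ => abs_nonneg (C j)) (Finset.mem_univ i)
    have h2 := Finset.single_le_sum (fun j _ => abs_nonneg (C j)) (Finset.mem_univ j)
    have h3 := le_abs_self (C i)
    have h4 := neg_abs_le (C j)
    linarith) hp hmin i
  by_contra! hcon
  rw [Real.sqrt_eq_zero_of_nonpos hcon] at h
  linarith

/-- The first-order optimality condition, as a quadratic growth of the objective. -/
theorem objective_add_bregman_le {K : ℕ} {η : ℝ} (hη : 0 < η) {C p q : Fin K → ℝ}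
    (hp : p ∈ stdSimplex ℝ (Fin K))
    (hmin : IsMinOn (objective η C) (stdSimplex ℝ (Fin K)) p)
    (hq : q ∈ stdSimplex ℝ (Fin K)) :
    objective η C p + η⁻¹ * bregman q p ≤ objective η C q := by
  have hpos := minimizer_pos hη hp hmin
  -- The slope at `p` along the segment to `q` is nonnegative by minimality, and it equals the
  -- objective gap minus the Bregman term exactly. Positivity of `p` makes the roots differentiable.
  let f : ℝ → ℝ := fun ε => objective η C (fun i => p i + ε * (q i - p i))
  let f' : ℝ := ∑ i, (q i - p i) * C i
    - η⁻¹ * ∑ i, (4 * ((q i - p i) / (2 * √(p i))) - 2 * (q i - p i))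
  have hline : ∀ i, HasDerivAt (fun ε : ℝ => p i + ε * (q i - p i)) (q i - p i) 0 := fun i => by
    simpa using ((hasDerivAt_id (0 : ℝ)).mul_const (q i - p i)).const_add (p i)
  have hder : HasDerivAt f f' 0 := by
    simp only [f, objective_eq]
    refine HasDerivAt.sub (HasDerivAt.fun_sum fun i _ => (hline i).mul_const _)
      (HasDerivAt.const_mul _ (HasDerivAt.fun_sum fun i _ => ?_))
    refine HasDerivAt.sub (HasDerivAt.const_mul _ ?_) ((hline i).const_mul _)
    have := (hline i).sqrt (by simpa using (hpos i).ne')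
    simpa using this
  have hf' : 0 ≤ f' := by
    have hlim := hder.tendsto_slope_zero_right
    refine ge_of_tendsto hlim ?_
    filter_upwards [Ioo_mem_nhdsGT (zero_lt_one (α := ℝ))] with ε hε
    have hmem : (fun i => p i + ε * (q i - p i)) ∈ stdSimplex ℝ (Fin K) := by
      constructor
      · intro i
        have h1 := hp.1 i
        have h2 := hq.1 i
        have : p i + ε * (q i - p i) = (1 - ε) * p i + ε * q i := by ring
        change 0 ≤ p i + ε * (q i - p i)
        rw [this]
        have h3 : 0 ≤ 1 - ε := by linarith [hε.2]
        have h4 := hε.1.le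
        positivity
      · rw [Finset.sum_add_distrib, ← Finset.mul_sum, Finset.sum_sub_distrib, hp.2, hq.2]
        ring
    have hle : objective η C p ≤ f ε := hmin hmem
    have h0 : f 0 = objective η C p := by simp [f]
    rw [zero_add, h0, smul_eq_mul]
    exact mul_nonneg (inv_nonneg.2 hε.1.le) (by linarith)
  have hid : objective η C q - objective η C p - η⁻¹ * bregman q p = f' := by
    rw [objective_eq, objective_eq, bregman]
    simp only [f']
    have : ∑ i, (4 * √(q i) - 2 * q i) - ∑ i, (4 * √(p i) - 2 * p i)
        + ∑ i, 2 * (√(q i) - √(p i)) ^ 2 / √(p i)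
        = ∑ i, (4 * ((q i - p i) / (2 * √(p i))) - 2 * (q i - p i)) := by
      rw [← Finset.sum_sub_distrib, ← Finset.sum_add_distrib]
      refine Finset.sum_congr rfl fun i _ => ?_
      have h1 : 0 < √(p i) := Real.sqrt_pos.2 (hpos i)
      have h2 := Real.sq_sqrt (hpos i).le
      have h3 := Real.sq_sqrt (hq.1 i)
      generalize √(p i) = a at *
      generalize √(q i) = b at *
      rw [← h2, ← h3]
      field_simp
      ring
    have hlin : ∑ i, (q i - p i) * C i = ∑ i, q i * C i - ∑ i, p i * C i := by
      rw [← Finset.sum_sub_distrib]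
      exact Finset.sum_congr rfl fun i _ => sub_mul _ _ _
    rw [← this, hlin]
    ring
  linarith

theorem exists_minimizer {K : ℕ} [NeZero K] (η : ℝ) (C : Fin K → ℝ) :
    ∃ p ∈ stdSimplex ℝ (Fin K), IsMinOn (objective η C) (stdSimplex ℝ (Fin K)) p := by
  refine (isCompact_stdSimplex ℝ (Fin K)).exists_isMinOn ⟨_, single_mem_stdSimplex ℝ (0 : Fin K)⟩ ?_
  apply Continuous.continuousOn
  unfold objective
  fun_prop

/-- On the simplex the Bregman term dominates half the squared sup distance, so quadratic growth
turns a perturbation of the losses into a linear change of the minimizer. Taking equal losses yields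
uniqueness, and letting them vary yields continuity, hence measurability of the sampling
distributions, which a run does not postulate. -/
theorem minimizer_lipschitz {K : ℕ} {η : ℝ} (hη : 0 < η) {C C' p p' : Fin K → ℝ}
    (hp : p ∈ stdSimplex ℝ (Fin K))
    (hmin : IsMinOn (objective η C) (stdSimplex ℝ (Fin K)) p)
    (hp' : p' ∈ stdSimplex ℝ (Fin K))
    (hmin' : IsMinOn (objective η C') (stdSimplex ℝ (Fin K)) p') (i : Fin K) :
    |p' i - p i| ≤ 2 * η * ∑ k, |C k - C' k| := by
  have h1 := objective_add_bregman_le hη hp hmin hp'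
  have h2 : objective η C' p' ≤ objective η C' p := hmin' hp
  set S := ∑ k, |C k - C' k| with hS
  have hS0 : 0 ≤ S := Finset.sum_nonneg fun _ _ => abs_nonneg _
  have : Nonempty (Fin K) := ⟨i⟩
  obtain ⟨j, -, hj⟩ := Finset.exists_max_image Finset.univ (fun k => |p' k - p k|)
    Finset.univ_nonempty
  set d := |p' j - p j| with hd
  refine (hj i (Finset.mem_univ i)).trans ?_
  have h3 : η⁻¹ * bregman p' p ≤ ∑ k, (p' k - p k) * (C k - C' k) := by
    rw [objective_eq, objective_eq] at h1 h2
    have : ∑ k, (p' k - p k) * (C k - C' k) = ∑ k, p' k * C k - ∑ k, p k * C k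
        - (∑ k, p' k * C' k - ∑ k, p k * C' k) := by
      simp only [← Finset.sum_sub_distrib]
      exact Finset.sum_congr rfl fun k _ => by ring
    rw [this]
    linarith
  have h4 : ∑ k, (p' k - p k) * (C k - C' k) ≤ d * S := by
    rw [hS, Finset.mul_sum]
    refine Finset.sum_le_sum fun k _ => ?_
    calc (p' k - p k) * (C k - C' k) ≤ |(p' k - p k) * (C k - C' k)| := le_abs_self _
      _ = |p' k - p k| * |C k - C' k| := abs_mul _ _
      _ ≤ d * |C k - C' k| := by gcongr; exact hj k (Finset.mem_univ k)
  have h5 : d ^ 2 / 2 ≤ bregman p' p := by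
    refine le_trans ?_ (Finset.single_le_sum (f := fun i => 2 * (√(p' i) - √(p i)) ^ 2 / √(p i))
      (fun _ _ => by positivity) (Finset.mem_univ j))
    have hpos := minimizer_pos hη hp hmin j
    have ha : 0 < √(p j) := Real.sqrt_pos.2 hpos
    have hb := Real.sqrt_nonneg (p' j)
    have ha1 : √(p j) ≤ 1 := Real.sqrt_le_one.2 (simplex_le_one hp j)
    have hb1 : √(p' j) ≤ 1 := Real.sqrt_le_one.2 (simplex_le_one hp' j)
    rw [hd, sq_abs]
    have e1 : p' j - p j = (√(p' j) - √(p j)) * (√(p' j) + √(p j)) := by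
      have h1 := Real.mul_self_sqrt hpos.le
      have h2 := Real.mul_self_sqrt (hp'.1 j)
      ring_nf; ring_nf at h1 h2; linarith
    rw [e1, mul_pow, le_div_iff₀ ha]
    have e2 : (√(p' j) + √(p j)) ^ 2 ≤ 4 := by nlinarith
    have e3 := sq_nonneg (√(p' j) - √(p j))
    calc (√(p' j) - √(p j)) ^ 2 * (√(p' j) + √(p j)) ^ 2 / 2 * √(p j)
        ≤ (√(p' j) - √(p j)) ^ 2 * 4 / 2 * 1 := by gcongr
      _ = _ := by ring
  have hd0 : 0 ≤ d := abs_nonneg _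
  have h6 : d ^ 2 / 2 ≤ η * (d * S) := by
    have := mul_le_mul_of_nonneg_left (h3.trans h4) hη.le
    rw [mul_inv_cancel_left₀ hη.ne'] at this
    linarith
  rcases hd0.eq_or_lt with h | h
  · rw [← h]; positivity
  · have : d * d ≤ d * (2 * η * S) := by linarith [sq d]
    exact le_of_mul_le_mul_left this h

theorem exists_measurable_minimizer {K : ℕ} [NeZero K] {η : ℝ} (hη : 0 < η) :
    ∃ φ : (Fin K → ℝ) → Fin K → ℝ, Measurable φ ∧
      ∀ C p, p ∈ stdSimplex ℝ (Fin K) →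
        IsMinOn (objective η C) (stdSimplex ℝ (Fin K)) p → p = φ C := by
  choose φ hφ hmin using fun C : Fin K → ℝ => exists_minimizer η C
  refine ⟨φ, ?_, fun C p hp hpm => ?_⟩
  · apply Continuous.measurable
    refine continuous_pi fun i => continuous_iff_continuousAt.2 fun C => ?_
    rw [ContinuousAt, tendsto_iff_dist_tendsto_zero]
    have hlim : Tendsto (fun C' : Fin K → ℝ => 2 * η * ∑ k, |C k - C' k|) (𝓝 C) (𝓝 0) := by
      have : Continuous fun C' : Fin K → ℝ => 2 * η * ∑ k, |C k - C' k| := by fun_prop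
      simpa using this.tendsto C
    exact squeeze_zero (fun _ => dist_nonneg)
      (fun C' => minimizer_lipschitz hη (hφ C) (hmin C) (hφ C') (hmin C') i) hlim
  · funext i
    have := minimizer_lipschitz hη (hφ C) (hmin C) hp hpm i
    simp only [sub_self, abs_zero, Finset.sum_const_zero, mul_zero] at this
    linarith [abs_nonpos_iff.1 this]

/-! ### Stability, penalty and the regret of follow the regularized leader -/

/-- The difference of the two sides is a square plus (√p - √q)² (1 + η √p g), up to a positive
factor. This replaces a Taylor expansion of the conjugate regularizer, and a mildly negative `g` is
allowed. -/
theorem stability_coordinate {η p q g : ℝ} (hη : 0 < η) (hp : 0 < p) (hq : 0 ≤ q)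
    (hg : 0 ≤ 1 + η * √p * g) :
    (p - q) * g - η⁻¹ * (2 * (√q - √p) ^ 2 / √p) ≤ η * (√p ^ 3 * g ^ 2) := by
  have ha : 0 < √p := Real.sqrt_pos.2 hp
  have h2 := Real.sq_sqrt hp.le
  have h3 := Real.sq_sqrt hq
  generalize √p = a at *
  generalize √q = b at *
  rw [← h2, ← h3, ← sub_nonneg]
  have key : η * (a ^ 3 * g ^ 2) - ((a ^ 2 - b ^ 2) * g - η⁻¹ * (2 * (b - a) ^ 2 / a))
      = (η * a)⁻¹ * ((a - b - η * a ^ 2 * g) ^ 2 + (a - b) ^ 2 * (1 + η * a * g)) := by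
    field_simp
    ring
  rw [key]
  positivity

/-- The stability term of a step of follow the regularized leader. -/
noncomputable def stability {K : ℕ} (η : ℝ) (p q c : Fin K → ℝ) : ℝ :=
  ∑ i, (p i - q i) * c i - η⁻¹ * bregman q p

/-- Adding a constant to all losses is invisible to p - q, since both have total mass one. With `x`
the observed block loss, the second moment becomes √p (1 - p) instead of √p, and this is what
removes the best arm from the bound. -/
theorem stability_le_of_shift {K : ℕ} {η : ℝ} (hη : 0 < η) {p q c : Fin K → ℝ}
    (hp : p ∈ stdSimplex ℝ (Fin K)) (hpos : ∀ i, 0 < p i)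
    (hq : q ∈ stdSimplex ℝ (Fin K)) (x : ℝ) (hx : ∀ i, 0 ≤ 1 + η * √(p i) * (c i - x)) :
    stability η p q c ≤ ∑ i, η * (√(p i) ^ 3 * (c i - x) ^ 2) := by
  have h0 : ∑ i, (p i - q i) * c i = ∑ i, (p i - q i) * (c i - x) := by
    simp_rw [mul_sub]
    rw [Finset.sum_sub_distrib, ← Finset.sum_mul, Finset.sum_sub_distrib (f := p), hp.2, hq.2]
    ring
  rw [stability, h0, bregman, Finset.mul_sum, ← Finset.sum_sub_distrib]
  exact Finset.sum_le_sum fun i _ => stability_coordinate hη (hpos i) (hq.1 i) (hx i)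

/-- The fallback for the early blocks in which η_n |B_n| > 1 and the shifted bound is not available.
-/
theorem stability_le_of_nonneg {K : ℕ} {η : ℝ} (hη : 0 < η) {p q c : Fin K → ℝ}
    (hq : q ∈ stdSimplex ℝ (Fin K)) (hc : ∀ i, 0 ≤ c i) :
    stability η p q c ≤ ∑ i, p i * c i := by
  have h1 : 0 ≤ η⁻¹ * bregman q p := mul_nonneg (inv_nonneg.2 hη.le) (bregman_nonneg q p)
  have h2 : ∑ i, (p i - q i) * c i ≤ ∑ i, p i * c i :=
    Finset.sum_le_sum fun i _ => by nlinarith [mul_nonneg (hq.1 i) (hc i)]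
  rw [stability]
  linarith

/-- At a vertex the regularizer is 2, and 4√x - 2x ≤ 2 because (√x - 1)² ≥ 0. So the coordinate `b`
pays for the comparator and only the roots of the other arms remain. -/
theorem regularizer_sub_two_le {K : ℕ} {p : Fin K → ℝ} (hp : p ∈ stdSimplex ℝ (Fin K))
    (b : Fin K) :
    ∑ i, (4 * √(p i) - 2 * p i) - 2 ≤ 4 * ∑ i ∈ Finset.univ.erase b, √(p i) := by
  rw [← Finset.add_sum_erase _ _ (Finset.mem_univ b), Finset.mul_sum]
  have h1 : ∑ i ∈ Finset.univ.erase b, (4 * √(p i) - 2 * p i)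
      ≤ ∑ i ∈ Finset.univ.erase b, 4 * √(p i) :=
    Finset.sum_le_sum fun i _ => by linarith [hp.1 i]
  have h2 := Real.sq_sqrt (hp.1 b)
  nlinarith [sq_nonneg (√(p b) - 1)]

/-- The regret of follow the regularized leader against the arm `b`. -/
theorem ftrl_regret {K : ℕ} {η : ℕ → ℝ} (hη : ∀ n, 1 ≤ n → 0 < η n) (hη0 : (η 0)⁻¹ = 0)
    (hmono : Monotone fun n => (η n)⁻¹)
    {C p c : ℕ → Fin K → ℝ} (hC0 : C 0 = 0) (hC : ∀ n i, C (n + 1) i = C n i + c (n + 1) i)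
    (hp : ∀ n, 1 ≤ n → p n ∈ stdSimplex ℝ (Fin K))
    (hmin : ∀ n, 1 ≤ n → IsMinOn (objective (η n) (C (n - 1))) (stdSimplex ℝ (Fin K)) (p n))
    (b : Fin K) (M : ℕ) :
    ∑ n ∈ Finset.Icc 1 M, (∑ i, p n i * c n i - c n b)
      ≤ ∑ n ∈ Finset.Icc 1 M, stability (η n) (p n) (p (n + 1)) (c n)
        + ∑ n ∈ Finset.Icc 1 (M + 1),
          ((η n)⁻¹ - (η (n - 1))⁻¹) * (4 * ∑ i ∈ Finset.univ.erase b, √(p n i)) := by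
  set h : ℕ → ℝ := fun n => ∑ i, (4 * √(p n i) - 2 * p n i) with hh
  have key : ∀ M, ∑ n ∈ Finset.Icc 1 M, ∑ i, p n i * c n i
      ≤ objective (η (M + 1)) (C M) (p (M + 1))
        + ∑ n ∈ Finset.Icc 1 M, stability (η n) (p n) (p (n + 1)) (c n)
        + ∑ n ∈ Finset.Icc 1 (M + 1), ((η n)⁻¹ - (η (n - 1))⁻¹) * h n := by
    intro M
    induction M with
    | zero => simp [objective_eq, hC0, hη0, hh]
    | succ M ih =>
      rw [Finset.sum_Icc_succ_top (by omega), Finset.sum_Icc_succ_top (by omega),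
        Finset.sum_Icc_succ_top (b := M + 1) (by omega)]
      have h1 := objective_add_bregman_le (hη (M + 1) (by omega)) (hp (M + 1) (by omega))
        (hmin (M + 1) (by omega)) (hp (M + 2) (by omega))
      simp only [Nat.add_sub_cancel] at h1 ⊢
      have h2 : objective (η (M + 1 + 1)) (C (M + 1)) (p (M + 1 + 1))
          = objective (η (M + 1)) (C M) (p (M + 2)) + ∑ i, p (M + 2) i * c (M + 1) i
            - ((η (M + 2))⁻¹ - (η (M + 1))⁻¹) * h (M + 2) := by
        rw [objective_eq, objective_eq]
        simp_rw [hC, mul_add]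
        rw [Finset.sum_add_distrib]
        simp only [hh]
        ring
      have h3 : stability (η (M + 1)) (p (M + 1)) (p (M + 1 + 1)) (c (M + 1))
          = ∑ i, p (M + 1) i * c (M + 1) i - ∑ i, p (M + 2) i * c (M + 1) i
            - (η (M + 1))⁻¹ * bregman (p (M + 2)) (p (M + 1)) := by
        rw [stability]
        simp_rw [sub_mul]
        rw [Finset.sum_sub_distrib]
      linarith
  have hCM : ∀ M, C M b = ∑ n ∈ Finset.Icc 1 M, c n b := by
    intro M
    induction M with
    | zero => simp [hC0]
    | succ M ih => rw [Finset.sum_Icc_succ_top (by omega), hC, ih]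
  have htel : ∀ M, (η M)⁻¹ = ∑ n ∈ Finset.Icc 1 M, ((η n)⁻¹ - (η (n - 1))⁻¹) := by
    intro M
    induction M with
    | zero => simp [hη0]
    | succ M ih =>
      rw [Finset.sum_Icc_succ_top (by omega), ← ih]
      simp
  -- Comparison with the vertex `b`. The term -2/η_{M+1} is then distributed over the increments of
  -- 1/η by telescoping, so that each regularizer value is reduced by 2.
  have hu : objective (η (M + 1)) (C M) (p (M + 1)) ≤ C M b - 2 * (η (M + 1))⁻¹ := by
    have h1 := hmin (M + 1) (by omega) (single_mem_stdSimplex ℝ b)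
    simp only [Nat.add_sub_cancel] at h1
    refine le_trans h1 (le_of_eq ?_)
    rw [objective_eq]
    have e1 : ∑ i, (Pi.single b (1 : ℝ) : Fin K → ℝ) i * C M i = C M b := by
      simp [Pi.single_apply]
    have e2 : ∑ i, (4 * √((Pi.single b (1 : ℝ) : Fin K → ℝ) i)
        - 2 * (Pi.single b (1 : ℝ) : Fin K → ℝ) i) = 2 := by
      rw [Finset.sum_eq_single b]
      · simp; norm_num
      · intro i _ hi; simp [hi]
      · simp
    rw [e1, e2]; ring
  have hpen : ∑ n ∈ Finset.Icc 1 (M + 1), ((η n)⁻¹ - (η (n - 1))⁻¹) * (h n - 2)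
      ≤ ∑ n ∈ Finset.Icc 1 (M + 1),
          ((η n)⁻¹ - (η (n - 1))⁻¹) * (4 * ∑ i ∈ Finset.univ.erase b, √(p n i)) := by
    refine Finset.sum_le_sum fun n hn => ?_
    have hn1 := (Finset.mem_Icc.1 hn).1
    refine mul_le_mul_of_nonneg_left (regularizer_sub_two_le (hp n hn1) b) ?_
    exact sub_nonneg.2 (hmono (Nat.sub_le n 1))
  simp_rw [mul_sub] at hpen
  rw [Finset.sum_sub_distrib, ← Finset.sum_mul, ← htel] at hpen
  rw [Finset.sum_sub_distrib, ← hCM]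
  linarith [key M]

/-! ### Arithmetic of the blocks -/

theorem blockEnd_succ (len : ℕ → ℕ) (n : ℕ) :
    blockEnd len (n + 1) = blockEnd len n + len (n + 1) := by
  rw [blockEnd, Finset.sum_Icc_succ_top (by omega), blockEnd]

theorem blockEnd_mono (len : ℕ → ℕ) : Monotone (blockEnd len) :=
  monotone_nat_of_le_succ fun n => by rw [blockEnd_succ]; omega

theorem blockOf_eq {len : ℕ → ℕ} {n t : ℕ} (h1 : blockEnd len n < t)
    (h2 : t ≤ blockEnd len (n + 1)) : blockOf len t = n + 1 := by
  refine le_antisymm (Nat.sInf_le h2) (le_csInf ⟨_, h2⟩ fun m hm => ?_)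
  by_contra! hlt
  have : blockEnd len m ≤ blockEnd len n := blockEnd_mono len (by omega)
  have hm' : t ≤ blockEnd len m := hm
  omega

theorem le_blockEnd {len : ℕ → ℕ} (hlen : ∀ n, 1 ≤ len n) (n : ℕ) : n ≤ blockEnd len n := by
  induction n with
  | zero => omega
  | succ n ih => rw [blockEnd_succ]; have := hlen (n + 1); omega

/-- The block of a round `T ≥ 1` starts before `T` and does not end before it. -/
theorem blockOf_spec {len : ℕ → ℕ} (hlen : ∀ n, 1 ≤ len n) {T : ℕ} (hT : 1 ≤ T) :
    ∃ M, blockOf len T = M + 1 ∧ blockEnd len M < T ∧ T ≤ blockEnd len (M + 1) := by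
  have hne : {n : ℕ | T ≤ blockEnd len n}.Nonempty := ⟨T, le_blockEnd hlen T⟩
  have hmem : T ≤ blockEnd len (blockOf len T) := Nat.sInf_mem hne
  obtain ⟨M, hM⟩ : ∃ M, blockOf len T = M + 1 := by
    refine ⟨blockOf len T - 1, (Nat.succ_pred_eq_of_ne_zero fun h => ?_).symm⟩
    rw [h] at hmem
    simp [blockEnd] at hmem
    omega
  refine ⟨M, hM, ?_, hM ▸ hmem⟩
  by_contra! h
  have : blockOf len T ≤ M := Nat.sInf_le h
  omega

theorem sum_Ioc_blockEnd (len : ℕ → ℕ) (f : ℕ → ℝ) (M : ℕ) :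
    ∑ t ∈ Finset.Ioc 0 (blockEnd len M), f t
      = ∑ n ∈ Finset.Icc 1 M, ∑ t ∈ Finset.Ioc (blockEnd len (n - 1)) (blockEnd len n), f t := by
  induction M with
  | zero => simp [blockEnd]
  | succ M ih =>
    rw [Finset.sum_Icc_succ_top (by omega), ← ih, Nat.add_sub_cancel,
      Finset.sum_Ioc_consecutive f (Nat.zero_le _) (blockEnd_mono len (Nat.le_succ M))]

theorem card_block (len : ℕ → ℕ) {n : ℕ} (hn : 1 ≤ n) :
    (Finset.Ioc (blockEnd len (n - 1)) (blockEnd len n)).card = len n := by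
  obtain ⟨m, rfl⟩ : ∃ m, n = m + 1 := ⟨n - 1, by omega⟩
  rw [Nat.card_Ioc, Nat.add_sub_cancel, blockEnd_succ]
  omega

/-! ### Loss estimates, information and measurability -/

theorem integrable_of_abs_le {Ω : Type*} [MeasurableSpace Ω] {P : Measure Ω}
    [IsProbabilityMeasure P] {f : Ω → ℝ} (hf : Measurable f) {B : ℝ} (hB : ∀ ω, |f ω| ≤ B) :
    Integrable f P :=
  Integrable.of_bound hf.aestronglyMeasurable B (Eventually.of_forall hB)

/-- The importance-weighted estimate of the losses of block `n`. -/
noncomputable def lossEstimate {K : ℕ} {Ω : Type*} (ℓ : ℕ → Ω → Fin K → ℝ) (len : ℕ → ℕ)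
    (I : ℕ → Ω → Fin K) (p : ℕ → Ω → Fin K → ℝ) (n : ℕ) (ω : Ω) (i : Fin K) : ℝ :=
  if I n ω = i then blockLoss ℓ len n ω i / p n ω i else 0

/-- The information given by the losses of the rounds before `t` and the actions of the blocks
`1, …, k`. -/
abbrev pastInfo {K : ℕ} {Ω : Type*} (ℓ : ℕ → Ω → Fin K → ℝ) (I : ℕ → Ω → Fin K)
    (t k : ℕ) : MeasurableSpace Ω :=
  pastLosses ℓ t ⊔ ⨆ m ∈ Set.Ico 1 (k + 1), MeasurableSpace.comap (I m) inferInstance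

/-- The expected probability of playing the arm `i` in block `n`. -/
noncomputable def meanProb {K : ℕ} {Ω : Type*} [MeasurableSpace Ω] (P : Measure Ω)
    (p : ℕ → Ω → Fin K → ℝ) (n : ℕ) (i : Fin K) : ℝ := ∫ ω, p n ω i ∂P

/-- The expected sum of the square roots of the probabilities of the arms other than `b`. -/
noncomputable def meanRoot {K : ℕ} {Ω : Type*} [MeasurableSpace Ω] (P : Measure Ω)
    (p : ℕ → Ω → Fin K → ℝ) (b : Fin K) (n : ℕ) : ℝ :=
  ∫ ω, ∑ i ∈ Finset.univ.erase b, √(p n ω i) ∂P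

section Information

variable {K : ℕ} {Ω : Type*} {ℓ : ℕ → Ω → Fin K → ℝ} {I : ℕ → Ω → Fin K}

theorem measurable_loss_pastLosses {s t : ℕ} (hs : 1 ≤ s) (hst : s < t) :
    Measurable[pastLosses ℓ t] (ℓ s) := by
  apply Measurable.of_comap_le
  exact le_iSup₂ (f := fun s (_ : s ∈ Set.Ico 1 t) =>
    MeasurableSpace.comap (ℓ s) inferInstance) s ⟨hs, hst⟩

theorem measurable_loss_pastInfo {s t k : ℕ} (hs : 1 ≤ s) (hst : s < t) :
    Measurable[pastInfo ℓ I t k] (ℓ s) :=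
  (measurable_loss_pastLosses hs hst).mono le_sup_left le_rfl

theorem measurable_action_pastInfo {t k m : ℕ} (hm : 1 ≤ m) (hmk : m ≤ k) :
    Measurable[pastInfo ℓ I t k] (I m) := by
  apply Measurable.of_comap_le
  refine le_trans ?_ le_sup_right
  exact le_iSup₂ (f := fun s (_ : s ∈ Set.Ico 1 (k + 1)) =>
    MeasurableSpace.comap (I s) inferInstance) m ⟨hm, by omega⟩

theorem measurable_loss_all {s n : ℕ} (hs : 1 ≤ s) :
    Measurable[lossesAndPastActions ℓ I n] (ℓ s) := by
  apply Measurable.of_comap_le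
  refine le_trans ?_ le_sup_left
  exact le_iSup₂ (f := fun s (_ : s ∈ Set.Ici 1) =>
    MeasurableSpace.comap (ℓ s) inferInstance) s hs

theorem measurable_action_all {n m : ℕ} (hm : 1 ≤ m) (hmn : m < n) :
    Measurable[lossesAndPastActions ℓ I n] (I m) := by
  apply Measurable.of_comap_le
  refine le_trans ?_ le_sup_right
  exact le_iSup₂ (f := fun s (_ : s ∈ Set.Ico 1 n) =>
    MeasurableSpace.comap (I s) inferInstance) m ⟨hm, hmn⟩

theorem pastInfo_le_all {t k : ℕ} :
    pastInfo ℓ I t k ≤ lossesAndPastActions ℓ I (k + 1) := by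
  refine sup_le_sup_right ?_ _
  exact iSup₂_le fun s hs => le_iSup₂ (f := fun s (_ : s ∈ Set.Ici 1) =>
    MeasurableSpace.comap (ℓ s) inferInstance) s hs.1

theorem pastInfo_zero {t : ℕ} : pastInfo ℓ I t 0 = pastLosses ℓ t := by
  simp

/-- On the event that the action of block `k + 1` is `a`, the information that this action adds is
void. -/
theorem exists_pastInfo_inter_eq {t k : ℕ} {A : Set Ω}
    (hA : MeasurableSet[pastInfo ℓ I t (k + 1)] A) (a : Fin K) :
    ∃ B, MeasurableSet[pastInfo ℓ I t k] B ∧ ∀ ω, I (k + 1) ω = a → (ω ∈ A ↔ ω ∈ B) := by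
  have hsplit : pastInfo ℓ I t (k + 1)
      = pastInfo ℓ I t k ⊔ MeasurableSpace.comap (I (k + 1)) inferInstance := by
    rw [pastInfo, pastInfo, sup_assoc]
    congr 1
    have : Set.Ico 1 (k + 1 + 1) = insert (k + 1) (Set.Ico 1 (k + 1)) := by
      ext m; simp
    rw [this, iSup_insert, sup_comm]
  -- Restricted to the event, the new action is constant and its σ-algebra is trivial, so the two
  -- σ-algebras have the same trace there.
  let v : {ω // I (k + 1) ω = a} → Ω := Subtype.val
  have hcomap : MeasurableSpace.comap v (pastInfo ℓ I t (k + 1))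
      ≤ MeasurableSpace.comap v (pastInfo ℓ I t k) := by
    rw [hsplit, MeasurableSpace.comap_sup, MeasurableSpace.comap_comp]
    have : I (k + 1) ∘ v = fun _ => a := by funext ω; exact ω.2
    rw [this, MeasurableSpace.comap_const]
    simp
  obtain ⟨B, hB, hBA⟩ := hcomap (v ⁻¹' A) ⟨A, hA, rfl⟩
  refine ⟨B, hB, fun ω hω => ?_⟩
  have := Set.ext_iff.1 hBA ⟨ω, hω⟩
  exact this.symm

end Information

section Measurability

variable {K : ℕ} {Ω : Type*} [MeasurableSpace Ω] {ℓ : ℕ → Ω → Fin K → ℝ} {len : ℕ → ℕ}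
  {I : ℕ → Ω → Fin K} {p : ℕ → Ω → Fin K → ℝ}

theorem measurable_blockLoss {n : ℕ} (hℓ : ∀ t, 1 ≤ t → t ≤ blockEnd len n → Measurable (ℓ t))
    (i : Fin K) : Measurable fun ω => blockLoss ℓ len n ω i := by
  unfold blockLoss
  refine Finset.measurable_fun_sum _ fun t ht => ?_
  have := Finset.mem_Ioc.1 ht
  exact (measurable_pi_apply i).comp (hℓ t (by omega) this.2)

theorem measurable_lossEstimate {n : ℕ}
    (hℓ : ∀ t, 1 ≤ t → t ≤ blockEnd len n → Measurable (ℓ t)) (hI : Measurable (I n))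
    (hp : Measurable (p n)) (i : Fin K) : Measurable fun ω => lossEstimate ℓ len I p n ω i :=
  Measurable.ite (hI (measurableSet_singleton i))
    ((measurable_blockLoss hℓ i).div ((measurable_pi_apply i).comp hp)) measurable_const

theorem measurable_cumEstimate {n : ℕ}
    (hℓ : ∀ t, 1 ≤ t → t ≤ blockEnd len n → Measurable (ℓ t))
    (hI : ∀ m, 1 ≤ m → m ≤ n → Measurable (I m)) (hp : ∀ m, 1 ≤ m → m ≤ n → Measurable (p m)) :
    Measurable (cumEstimate ℓ len I p n) := by
  refine measurable_pi_lambda _ fun i => Finset.measurable_fun_sum _ fun m hm => ?_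
  obtain ⟨hm1, hmn⟩ := Finset.mem_Icc.1 hm
  exact measurable_lossEstimate (fun t ht htm => hℓ t ht (htm.trans (blockEnd_mono len hmn)))
    (hI m hm1 hmn) (hp m hm1 hmn) i

/-- The sampling distribution of block `n + 1` is a function of the losses and actions of the
blocks `1, …, n`. -/
theorem measurable_distribution
    (hp : ∀ n, ∃ φ : (Fin K → ℝ) → Fin K → ℝ, Measurable φ ∧
      ∀ ω, p (n + 1) ω = φ (cumEstimate ℓ len I p n ω)) (n : ℕ)
    (hℓ : ∀ t, 1 ≤ t → t ≤ blockEnd len n → Measurable (ℓ t))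
    (hI : ∀ m, 1 ≤ m → m ≤ n → Measurable (I m)) :
    Measurable (p (n + 1)) := by
  induction n using Nat.strong_induction_on with
  | _ n ih =>
    obtain ⟨φ, hφ, hφp⟩ := hp n
    rw [funext hφp]
    refine hφ.comp (measurable_cumEstimate hℓ hI fun m hm hmn => ?_)
    obtain ⟨k, rfl⟩ : ∃ k, m = k + 1 := ⟨m - 1, by omega⟩
    exact ih k (by omega)
      (fun t ht htk => hℓ t ht (htk.trans (blockEnd_mono len (by omega))))
      (fun m hm hmk => hI m hm (by omega))

end Measurability

/-! ### Properties of a run -/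

section Run

set_option linter.unusedSectionVars false

variable {K : ℕ} [NeZero K] {Ω : Type*} [mΩ : MeasurableSpace Ω] {P : Measure Ω}
  [IsProbabilityMeasure P] {ℓ : ℕ → Ω → Fin K → ℝ} {gap : Fin K → Fin K → ℝ} {len : ℕ → ℕ}
  {η : ℕ → ℝ} {I : ℕ → Ω → Fin K} {p : ℕ → Ω → Fin K → ℝ}

theorem lossesAndPastActions_le (henv : IsStochConstrained P ℓ gap)
    (hrun : IsRun P ℓ len η I p) (n : ℕ) : lossesAndPastActions ℓ I n ≤ mΩ :=
  sup_le (iSup₂_le fun t ht => (henv.measurable_loss t ht).comap_le)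
    (iSup₂_le fun m hm => (hrun.measurable_action m hm.1).comap_le)

theorem blockLoss_mem (henv : IsStochConstrained P ℓ gap) {n : ℕ} (hn : 1 ≤ n) (ω : Ω)
    (i : Fin K) : blockLoss ℓ len n ω i ∈ Set.Icc (0 : ℝ) (len n) := by
  have h : ∀ t ∈ Finset.Ioc (blockEnd len (n - 1)) (blockEnd len n),
      ℓ t ω i ∈ Set.Icc (0 : ℝ) 1 := fun t ht =>
    henv.mem_Icc t (by have := (Finset.mem_Ioc.1 ht).1; omega) ω i
  refine ⟨Finset.sum_nonneg fun t ht => (h t ht).1, ?_⟩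
  refine (Finset.sum_le_card_nsmul _ _ 1 fun t ht => (h t ht).2).trans ?_
  rw [card_block len hn, nsmul_eq_mul, mul_one]

theorem cumEstimate_succ (n : ℕ) (ω : Ω) (i : Fin K) :
    cumEstimate ℓ len I p (n + 1) ω i
      = cumEstimate ℓ len I p n ω i + lossEstimate ℓ len I p (n + 1) ω i := by
  rw [cumEstimate, Finset.sum_Icc_succ_top (by omega)]
  rfl

theorem lossEstimate_nonneg (henv : IsStochConstrained P ℓ gap) (hrun : IsRun P ℓ len η I p)
    {n : ℕ} (hn : 1 ≤ n) (ω : Ω) (i : Fin K) : 0 ≤ lossEstimate ℓ len I p n ω i := by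
  unfold lossEstimate
  split_ifs
  · exact div_nonneg (blockLoss_mem henv hn ω i).1 ((hrun.mem_simplex n hn ω).1 i)
  · exact le_rfl

theorem exists_distribution_eq (hη : ∀ n, 1 ≤ n → 0 < η n) (hrun : IsRun P ℓ len η I p) (n : ℕ) :
    ∃ φ : (Fin K → ℝ) → Fin K → ℝ, Measurable φ ∧
      ∀ ω, p (n + 1) ω = φ (cumEstimate ℓ len I p n ω) := by
  obtain ⟨φ, hφ, hφp⟩ := exists_measurable_minimizer (K := K) (hη (n + 1) (by omega))
  exact ⟨φ, hφ, fun ω => hφp _ _ (hrun.mem_simplex _ (by omega) ω)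
    (hrun.isMinOn (n + 1) (by omega) ω)⟩

/-- `measurable_distribution` holds for any σ-algebra on Ω, so it is applied here with the
conditioning σ-algebra in place of the ambient one. -/
theorem measurable_distribution_all (hη : ∀ n, 1 ≤ n → 0 < η n) (hrun : IsRun P ℓ len η I p)
    {n : ℕ} (hn : 1 ≤ n) (i : Fin K) :
    Measurable[lossesAndPastActions ℓ I n] fun ω => p n ω i := by
  obtain ⟨k, rfl⟩ : ∃ k, n = k + 1 := ⟨n - 1, by omega⟩
  exact (measurable_pi_apply i).comp (@measurable_distribution K Ω (lossesAndPastActions ℓ I (k + 1))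
    _ _ _ _ (exists_distribution_eq hη hrun) k (fun t ht _ => measurable_loss_all ht)
    fun m hm hmk => measurable_action_all hm (by omega))

theorem measurable_distribution_past (hη : ∀ n, 1 ≤ n → 0 < η n) (hrun : IsRun P ℓ len η I p)
    {t k : ℕ} (ht : blockEnd len k < t) (i : Fin K) :
    Measurable[pastInfo ℓ I t k] fun ω => p (k + 1) ω i :=
  (measurable_pi_apply i).comp (@measurable_distribution K Ω (pastInfo ℓ I t k)
    _ _ _ _ (exists_distribution_eq hη hrun) k
    (fun _ hs hsk => measurable_loss_pastInfo hs (by omega))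
    fun _ hm hmk => measurable_action_pastInfo hm hmk)

theorem distribution_pos (hη : ∀ n, 1 ≤ n → 0 < η n) (hrun : IsRun P ℓ len η I p) {n : ℕ}
    (hn : 1 ≤ n) (ω : Ω) (i : Fin K) : 0 < p n ω i :=
  minimizer_pos (hη n hn) (hrun.mem_simplex n hn ω) (hrun.isMinOn n hn ω) i

/-- Bounded cumulative estimates keep the minimizer away from zero uniformly in ω, and this in turn
bounds the next estimate. The value of δ is irrelevant; it provides boundedness, hence
integrability, of all importance-weighted quantities. -/
theorem distribution_lower_bound (hη : ∀ n, 1 ≤ n → 0 < η n) (henv : IsStochConstrained P ℓ gap)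
    (hrun : IsRun P ℓ len η I p) {n : ℕ} (hn : 1 ≤ n) : ∃ δ > 0, ∀ ω i, δ ≤ p n ω i := by
  have hK : 0 < K := Nat.pos_of_ne_zero (NeZero.ne K)
  have step : ∀ n B, (∀ ω i, cumEstimate ℓ len I p n ω i ∈ Set.Icc 0 B) →
      ∃ δ > 0, ∀ ω i, δ ≤ p (n + 1) ω i := by
    intro n B hB
    have hB' : ∀ ω (i j : Fin K), cumEstimate ℓ len I p n ω i - cumEstimate ℓ len I p n ω j ≤ |B| :=
      fun ω i j => by linarith [(hB ω i).2, (hB ω j).1, le_abs_self B]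
    have hηn := hη (n + 1) (by omega)
    set M := 2 * (η (n + 1) * |B| / 4 + √K) with hM
    have hM0 : 0 < M := by
      have : 0 < √(K : ℝ) := Real.sqrt_pos.2 (by exact_mod_cast hK)
      positivity
    refine ⟨(1 / M) ^ 2, by positivity, fun ω i => ?_⟩
    have h : 1 ≤ M * √(p (n + 1) ω i) := minimizer_lower_bound hK hηn (hB' ω) (hrun.mem_simplex (n + 1) (by omega) ω)
      (hrun.isMinOn (n + 1) (by omega) ω) i
    rw [← Real.sq_sqrt ((hrun.mem_simplex (n + 1) (by omega) ω).1 i)]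
    gcongr
    rw [div_le_iff₀ hM0]
    linarith
  have bdd : ∀ n, ∃ B, ∀ ω i, cumEstimate ℓ len I p n ω i ∈ Set.Icc 0 B := by
    intro n
    induction n with
    | zero => exact ⟨0, fun ω i => by simp [cumEstimate]⟩
    | succ n ih =>
      obtain ⟨B, hB⟩ := ih
      obtain ⟨δ, hδ, hδp⟩ := step n B hB
      refine ⟨B + len (n + 1) / δ, fun ω i => ?_⟩
      rw [cumEstimate_succ]
      refine ⟨add_nonneg (hB ω i).1 (lossEstimate_nonneg henv hrun (by omega) ω i),
        add_le_add (hB ω i).2 ?_⟩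
      unfold lossEstimate
      split_ifs
      · have := blockLoss_mem (len := len) henv (n := n + 1) (by omega) ω i
        exact div_le_div₀ (this.1.trans this.2) this.2 hδ (hδp ω i)
      · positivity
  obtain ⟨k, rfl⟩ : ∃ k, n = k + 1 := ⟨n - 1, by omega⟩
  obtain ⟨B, hB⟩ := bdd k
  exact step k B hB

/-- The arm of block `n` is drawn from `p n`, whatever the losses and the earlier actions are. -/
theorem integral_mul_action (henv : IsStochConstrained P ℓ gap) (hrun : IsRun P ℓ len η I p)
    {n : ℕ} (hn : 1 ≤ n) (i : Fin K) {f : Ω → ℝ}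
    (hf : Measurable[lossesAndPastActions ℓ I n] f) {B : ℝ} (hB : ∀ ω, |f ω| ≤ B) :
    ∫ ω, f ω * (if I n ω = i then 1 else 0) ∂P = ∫ ω, f ω * p n ω i ∂P := by
  have hle := lossesAndPastActions_le henv hrun n
  let g : Ω → ℝ := Set.indicator {ω | I n ω = i} fun _ => 1
  have hS : MeasurableSet {ω | I n ω = i} :=
    hrun.measurable_action n hn (measurableSet_singleton i)
  have hg : Integrable g P := (integrable_const 1).indicator hS
  have hfg : Integrable (f * g) P := by
    refine integrable_of_abs_le (B := B)
      ((hf.mono hle le_rfl).mul (measurable_const.indicator hS)) fun ω => ?_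
    rw [Pi.mul_apply, abs_mul]
    have h1 : |g ω| ≤ 1 := by
      simp only [g, Set.indicator_apply]
      split_ifs <;> simp
    calc |f ω| * |g ω| ≤ |f ω| * 1 := by gcongr
      _ ≤ B := by rw [mul_one]; exact hB ω
  have h1 := condExp_mul_of_stronglyMeasurable_left
    (hf.stronglyMeasurable) hfg hg
  calc ∫ ω, f ω * (if I n ω = i then 1 else 0) ∂P = ∫ ω, (f * g) ω ∂P := by
        refine integral_congr_ae (Eventually.of_forall fun ω => ?_)
        simp [g, Set.indicator_apply]
    _ = ∫ ω, (P[f * g | lossesAndPastActions ℓ I n]) ω ∂P := (integral_condExp hle).symm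
    _ = ∫ ω, f ω * p n ω i ∂P := by
        refine integral_congr_ae ?_
        filter_upwards [h1, hrun.sample n hn i] with ω h1 h2
        rw [h1, Pi.mul_apply, h2]

end Run

/-! ### Expected regret of a round and self-bounding -/

section Regret

set_option linter.unusedSectionVars false

variable {K : ℕ} [NeZero K] {Ω : Type*} [mΩ : MeasurableSpace Ω] {P : Measure Ω}
  [IsProbabilityMeasure P] {ℓ : ℕ → Ω → Fin K → ℝ} {gap : Fin K → Fin K → ℝ} {len : ℕ → ℕ}
  {η : ℕ → ℝ} {I : ℕ → Ω → Fin K} {p : ℕ → Ω → Fin K → ℝ}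

theorem pastInfo_le (henv : IsStochConstrained P ℓ gap) (hrun : IsRun P ℓ len η I p) (t k : ℕ) :
    pastInfo ℓ I t k ≤ mΩ :=
  pastInfo_le_all.trans (lossesAndPastActions_le henv hrun (k + 1))

theorem measurable_loss_apply (henv : IsStochConstrained P ℓ gap) {t : ℕ} (ht : 1 ≤ t)
    (i : Fin K) : Measurable fun ω => ℓ t ω i :=
  (measurable_pi_apply i).comp (henv.measurable_loss t ht)

theorem abs_loss_sub_le (henv : IsStochConstrained P ℓ gap) {t : ℕ} (ht : 1 ≤ t) (i j : Fin K)
    (ω : Ω) : |ℓ t ω i - ℓ t ω j| ≤ 1 := by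
  have h1 := henv.mem_Icc t ht ω i
  have h2 := henv.mem_Icc t ht ω j
  rw [abs_le]
  constructor <;> linarith [h1.1, h1.2, h2.1, h2.2]

theorem integrable_loss (henv : IsStochConstrained P ℓ gap) {t : ℕ} (ht : 1 ≤ t)
    (i : Fin K) : Integrable (fun ω => ℓ t ω i) P :=
  integrable_of_abs_le (B := 1) (measurable_loss_apply henv ht i) fun ω => by
    have h1 := henv.mem_Icc t ht ω i
    rw [abs_le]
    constructor <;> linarith [h1.1, h1.2]

theorem measurable_distribution_apply (hη : ∀ n, 1 ≤ n → 0 < η n)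
    (henv : IsStochConstrained P ℓ gap) (hrun : IsRun P ℓ len η I p) {n : ℕ} (hn : 1 ≤ n)
    (i : Fin K) : Measurable fun ω => p n ω i :=
  (measurable_distribution_all hη hrun hn i).mono (lossesAndPastActions_le henv hrun n) le_rfl

theorem integrable_distribution (hη : ∀ n, 1 ≤ n → 0 < η n)
    (henv : IsStochConstrained P ℓ gap) (hrun : IsRun P ℓ len η I p) {n : ℕ} (hn : 1 ≤ n)
    (i : Fin K) : Integrable (fun ω => p n ω i) P :=
  integrable_of_abs_le (B := 1) (measurable_distribution_apply hη henv hrun hn i) fun ω => by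
    rw [abs_of_nonneg ((hrun.mem_simplex n hn ω).1 i)]
    exact simplex_le_one (hrun.mem_simplex n hn ω) i

theorem abs_action_le (n : ℕ) (i : Fin K) (ω : Ω) :
    |(if I n ω = i then 1 else 0 : ℝ)| ≤ 1 := by
  split_ifs <;> simp

theorem measurable_action_apply (hrun : IsRun P ℓ len η I p) {n : ℕ} (hn : 1 ≤ n) (i : Fin K) :
    Measurable fun ω => (if I n ω = i then 1 else 0 : ℝ) :=
  Measurable.ite (hrun.measurable_action n hn (measurableSet_singleton i)) measurable_const
    measurable_const

theorem integral_action (henv : IsStochConstrained P ℓ gap) (hrun : IsRun P ℓ len η I p)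
    {n : ℕ} (hn : 1 ≤ n) (i : Fin K) :
    ∫ ω, (if I n ω = i then 1 else 0 : ℝ) ∂P = meanProb P p n i := by
  have := integral_mul_action henv hrun hn i (f := fun _ => 1) measurable_const (B := 1)
    (fun _ => by simp)
  simpa [meanProb] using this

/-- The actions carry no information on the loss differences of the later rounds. -/
theorem condExp_loss_sub_pastInfo (hη : ∀ n, 1 ≤ n → 0 < η n) (henv : IsStochConstrained P ℓ gap)
    (hrun : IsRun P ℓ len η I p) {t k : ℕ} (ht : 1 ≤ t)
    (hk : ∀ m, m < k → blockEnd len m < t) (i j : Fin K) :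
    P[fun ω => ℓ t ω i - ℓ t ω j | pastInfo ℓ I t k] =ᵐ[P] fun _ => gap i j := by
  classical
  induction k with
  | zero => rw [pastInfo_zero]; exact henv.gap_eq t ht i j
  | succ k ih =>
    have ih := ih fun m hm => hk m (by omega)
    set X : Ω → ℝ := fun ω => ℓ t ω i - ℓ t ω j with hX
    have hXm : Measurable X :=
      (measurable_loss_apply henv ht i).sub (measurable_loss_apply henv ht j)
    have hXb : ∀ ω, |X ω| ≤ 1 := abs_loss_sub_le henv ht i j
    have hXi : Integrable X P := integrable_of_abs_le hXm hXb
    have hle := pastInfo_le henv hrun t k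
    have hle' := pastInfo_le henv hrun t (k + 1)
    symm
    refine ae_eq_condExp_of_forall_setIntegral_eq hle' hXi
      (fun s _ _ => (integrable_const _).integrableOn) (fun A hA _ => ?_)
      (@stronglyMeasurable_const _ _ (pastInfo ℓ I t (k + 1)) _ _).aestronglyMeasurable
    -- Split `A` according to the action of block k + 1. On each piece `A` agrees with an event `B
    -- a` of the smaller σ-algebra, so only the indicator of the action is new, and sampling
    -- replaces it by p_{k+1,a}.
    choose B hB hAB using fun a => exists_pastInfo_inter_eq hA a
    have hsum : ∀ g : Ω → ℝ, Measurable g → (∀ ω, |g ω| ≤ 1) →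
        ∫ ω in A, g ω ∂P
          = ∑ a, ∫ ω, ((B a).indicator g ω) * (if I (k + 1) ω = a then 1 else 0) ∂P := by
      intro g hg hgb
      rw [← integral_indicator (hle' A hA), ← integral_finsetSum]
      · refine integral_congr_ae (Eventually.of_forall fun ω => ?_)
        simp only [Set.indicator_apply]
        rw [Finset.sum_eq_single (I (k + 1) ω)]
        · simp [hAB (I (k + 1) ω) ω rfl]
        · intro a _ ha
          simp [ha.symm]
        · simp
      · intro a _
        refine integrable_of_abs_le (B := 1) ((hg.indicator (hle _ (hB a))).mul
          (measurable_action_apply hrun (by omega) a)) fun ω => ?_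
        have h1 := hgb ω
        rw [Set.indicator_apply]
        split_ifs <;> simp [h1]
    have hconst : ∫ ω in A, gap i j ∂P
        = gap i j * ∫ ω in A, (1 : ℝ) ∂P := by simp [mul_comm]
    rw [hconst, hsum _ measurable_const (by simp), hsum X hXm hXb, Finset.mul_sum]
    refine Finset.sum_congr rfl fun a _ => ?_
    have hBall := pastInfo_le_all _ (hB a)
    have hXall : Measurable[lossesAndPastActions ℓ I (k + 1)] X :=
      Measurable.sub ((measurable_pi_apply i).comp (measurable_loss_all ht))
        ((measurable_pi_apply j).comp (measurable_loss_all ht))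
    rw [integral_mul_action henv hrun (by omega) a
        (measurable_const.indicator hBall) (B := 1) fun ω => by
          rw [Set.indicator_apply]; split_ifs <;> simp,
      integral_mul_action henv hrun (by omega) a (hXall.indicator hBall) (B := 1) fun ω => by
          rw [Set.indicator_apply]; split_ifs <;> simp [hXb]]
    -- Block k ends before round t, so p_{k+1,a} is known from the smaller σ-algebra. It can be
    -- pulled out of the conditional expectation, and the induction hypothesis applies.
    set Z : Ω → ℝ := (B a).indicator fun ω => p (k + 1) ω a with hZ
    have hZm : Measurable[pastInfo ℓ I t k] Z :=
      (measurable_distribution_past hη hrun (hk k (by omega)) a).indicator (hB a)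
    have hZb : ∀ ω, |Z ω| ≤ 1 := fun ω => by
      have hs := hrun.mem_simplex (k + 1) (by omega) ω
      rw [hZ, Set.indicator_apply]
      split_ifs
      · rw [abs_of_nonneg (hs.1 a)]; exact simplex_le_one hs a
      · simp
    have hXZ : Integrable (X * Z) P :=
      integrable_of_abs_le (B := 1) (hXm.mul (hZm.mono hle le_rfl)) fun ω => by
        rw [Pi.mul_apply, abs_mul]
        exact mul_le_one₀ (hXb ω) (abs_nonneg _) (hZb ω)
    have hpull := condExp_mul_of_stronglyMeasurable_right hZm.stronglyMeasurable hXZ hXi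
    calc gap i j * ∫ ω, (B a).indicator (fun _ => (1 : ℝ)) ω * p (k + 1) ω a ∂P
        = ∫ ω, gap i j * Z ω ∂P := by
          rw [← integral_const_mul]
          refine integral_congr_ae (Eventually.of_forall fun ω => ?_)
          simp [hZ, Set.indicator_apply]
      _ = ∫ ω, (P[X * Z | pastInfo ℓ I t k]) ω ∂P := by
          refine integral_congr_ae ?_
          filter_upwards [hpull, ih] with ω h1 h2
          rw [h1, Pi.mul_apply, h2]
      _ = ∫ ω, (X * Z) ω ∂P := integral_condExp hle
      _ = ∫ ω, (B a).indicator X ω * p (k + 1) ω a ∂P := by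
          refine integral_congr_ae (Eventually.of_forall fun ω => ?_)
          simp only [hZ, Pi.mul_apply, Set.indicator_apply]
          split_ifs <;> simp

theorem integral_loss_sub_mul_action (hη : ∀ n, 1 ≤ n → 0 < η n)
    (henv : IsStochConstrained P ℓ gap) (hrun : IsRun P ℓ len η I p) {t n : ℕ} (hn : 1 ≤ n)
    (ht : blockEnd len (n - 1) < t) (i j : Fin K) :
    ∫ ω, (ℓ t ω i - ℓ t ω j) * (if I n ω = i then 1 else 0) ∂P = gap i j * meanProb P p n i := by
  have ht1 : 1 ≤ t := by omega
  -- The action of block n itself belongs to the conditioning, although t may lie inside the block: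
  -- the draw only needs block n - 1 to have ended.
  have hce := condExp_loss_sub_pastInfo hη henv hrun (k := n) ht1
    (fun m hm => lt_of_le_of_lt (blockEnd_mono len (by omega)) ht) i j
  have hle := pastInfo_le henv hrun t n
  let X : Ω → ℝ := fun ω => ℓ t ω i - ℓ t ω j
  let Z : Ω → ℝ := fun ω => if I n ω = i then 1 else 0
  have hZm : Measurable[pastInfo ℓ I t n] Z :=
    Measurable.ite (measurable_action_pastInfo hn le_rfl (measurableSet_singleton i))
      measurable_const measurable_const
  have hXm : Measurable X :=
    (measurable_loss_apply henv ht1 i).sub (measurable_loss_apply henv ht1 j)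
  have hXb : ∀ ω, |X ω| ≤ 1 := abs_loss_sub_le henv ht1 i j
  have hXZ : Integrable (X * Z) P :=
    integrable_of_abs_le (B := 1) (hXm.mul (hZm.mono hle le_rfl)) fun ω => by
      rw [Pi.mul_apply, abs_mul]
      exact mul_le_one₀ (hXb ω) (abs_nonneg _) (abs_action_le n i ω)
  have hpull := condExp_mul_of_stronglyMeasurable_right hZm.stronglyMeasurable hXZ
    (integrable_of_abs_le hXm hXb)
  calc ∫ ω, (ℓ t ω i - ℓ t ω j) * (if I n ω = i then 1 else 0) ∂P
      = ∫ ω, (P[X * Z | pastInfo ℓ I t n]) ω ∂P := (integral_condExp hle).symm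
    _ = ∫ ω, gap i j * Z ω ∂P := by
        refine integral_congr_ae ?_
        filter_upwards [hpull, hce] with ω h1 h2
        rw [h1, Pi.mul_apply]
        exact congrArg (· * Z ω) h2
    _ = gap i j * meanProb P p n i := by
        rw [integral_const_mul, integral_action henv hrun hn i]

theorem integral_loss_sub (henv : IsStochConstrained P ℓ gap) {t : ℕ} (ht : 1 ≤ t)
    (i j : Fin K) : ∫ ω, ℓ t ω i ∂P - ∫ ω, ℓ t ω j ∂P = gap i j := by
  rw [← integral_sub (integrable_loss henv ht i) (integrable_loss henv ht j)]
  have hle : pastLosses ℓ t ≤ mΩ :=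
    iSup₂_le fun s hs => (henv.measurable_loss s hs.1).comap_le
  rw [← integral_condExp hle, integral_congr_ae (henv.gap_eq t ht i j)]
  simp

/-- Additivity of the gaps is not assumed; it is read off from the expectations in round 1. The
minimum defining the suboptimality gaps is attained at `best`, since an arm attaining it has gap
zero. -/
theorem gap_best_eq_subopt (henv : IsStochConstrained P ℓ gap) {best : Fin K}
    (hbest : ∀ i, i ≠ best → 0 < subopt gap i) (i : Fin K) : gap i best = subopt gap i := by
  have hmin : ⨅ j, gap j 0 = gap best 0 := by
    obtain ⟨j, hj⟩ := exists_eq_ciInf_of_finite (f := fun j => gap j 0)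
    by_cases h : j = best
    · rw [← hj, h]
    · have := hbest j h
      rw [subopt, ← hj] at this
      simp at this
  rw [subopt, hmin, ← integral_loss_sub henv le_rfl i best, ← integral_loss_sub henv le_rfl i 0,
    ← integral_loss_sub henv le_rfl best 0]
  ring

theorem subopt_best (henv : IsStochConstrained P ℓ gap) {best : Fin K}
    (hbest : ∀ i, i ≠ best → 0 < subopt gap i) : subopt gap best = 0 := by
  rw [← gap_best_eq_subopt henv hbest best, ← integral_loss_sub henv le_rfl best best, sub_self]

theorem subopt_nonneg (henv : IsStochConstrained P ℓ gap) {best : Fin K}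
    (hbest : ∀ i, i ≠ best → 0 < subopt gap i) (i : Fin K) : 0 ≤ subopt gap i := by
  by_cases h : i = best
  · rw [h, subopt_best henv hbest]
  · exact (hbest i h).le

theorem subopt_le_one (henv : IsStochConstrained P ℓ gap) {best : Fin K}
    (hbest : ∀ i, i ≠ best → 0 < subopt gap i) (i : Fin K) : subopt gap i ≤ 1 := by
  rw [← gap_best_eq_subopt henv hbest i, ← integral_loss_sub henv le_rfl i best,
    ← integral_sub (integrable_loss henv le_rfl i) (integrable_loss henv le_rfl best)]
  calc ∫ ω, ℓ 1 ω i - ℓ 1 ω best ∂P ≤ ∫ _, (1 : ℝ) ∂P :=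
        integral_mono ((integrable_loss henv le_rfl i).sub (integrable_loss henv le_rfl best))
          (integrable_const 1)
          fun ω => (le_abs_self _).trans (abs_loss_sub_le henv le_rfl i best ω)
    _ = 1 := by simp

theorem integrable_played_loss (henv : IsStochConstrained P ℓ gap)
    (hrun : IsRun P ℓ len η I p) {t n : ℕ} (ht : 1 ≤ t) (hn : 1 ≤ n) :
    Integrable (fun ω => ℓ t ω (I n ω)) P := by
  have h : (fun ω => ℓ t ω (I n ω))
      = fun ω => ∑ i, ℓ t ω i * (if I n ω = i then 1 else 0) := by
    funext ω; simp
  refine integrable_of_abs_le (B := 1) ?_ fun ω => ?_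
  · rw [h]
    exact Finset.measurable_fun_sum _ fun i _ =>
      (measurable_loss_apply henv ht i).mul (measurable_action_apply hrun hn i)
  · have h1 := henv.mem_Icc t ht ω (I n ω)
    rw [abs_le]
    constructor <;> linarith [h1.1, h1.2]

/-- The expected regret in a round of block `n`. -/
theorem integral_played_loss_sub (hη : ∀ n, 1 ≤ n → 0 < η n)
    (henv : IsStochConstrained P ℓ gap) (hrun : IsRun P ℓ len η I p) {best : Fin K}
    (hbest : ∀ i, i ≠ best → 0 < subopt gap i) {t n : ℕ} (hn : 1 ≤ n)
    (ht : blockEnd len (n - 1) < t) :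
    ∫ ω, ℓ t ω (I n ω) ∂P - ∫ ω, ℓ t ω best ∂P = ∑ i, subopt gap i * meanProb P p n i := by
  have ht1 : 1 ≤ t := by omega
  rw [← integral_sub (integrable_played_loss henv hrun ht1 hn) (integrable_loss henv ht1 best)]
  simp_rw [← gap_best_eq_subopt henv hbest, ← integral_loss_sub_mul_action hη henv hrun hn ht]
  rw [← integral_finsetSum]
  · refine integral_congr_ae (Eventually.of_forall fun ω => ?_)
    simp
  · intro i _
    refine integrable_of_abs_le (B := 1) (((measurable_loss_apply henv ht1 i).sub
      (measurable_loss_apply henv ht1 best)).mul (measurable_action_apply hrun hn i)) fun ω => ?_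
    rw [abs_mul]
    exact mul_le_one₀ (abs_loss_sub_le henv ht1 i best ω) (abs_nonneg _) (abs_action_le n i ω)

theorem meanProb_nonneg (hrun : IsRun P ℓ len η I p) {n : ℕ} (hn : 1 ≤ n) (i : Fin K) :
    0 ≤ meanProb P p n i :=
  integral_nonneg fun ω => (hrun.mem_simplex n hn ω).1 i

theorem sum_meanProb (hη : ∀ n, 1 ≤ n → 0 < η n) (henv : IsStochConstrained P ℓ gap)
    (hrun : IsRun P ℓ len η I p) {n : ℕ} (hn : 1 ≤ n) : ∑ i, meanProb P p n i = 1 := by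
  simp only [meanProb]
  rw [← integral_finsetSum _ fun i _ => integrable_distribution hη henv hrun hn i]
  simp [(hrun.mem_simplex n hn _).2]

theorem integrable_root (hη : ∀ n, 1 ≤ n → 0 < η n) (henv : IsStochConstrained P ℓ gap)
    (hrun : IsRun P ℓ len η I p) {n : ℕ} (hn : 1 ≤ n) (i : Fin K) :
    Integrable (fun ω => √(p n ω i)) P :=
  integrable_of_abs_le (B := 1) (measurable_distribution_apply hη henv hrun hn i).sqrt fun ω => by
    rw [abs_of_nonneg (Real.sqrt_nonneg _)]
    exact Real.sqrt_le_one.2 (simplex_le_one (hrun.mem_simplex n hn ω) i)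

theorem meanRoot_eq_sum (hη : ∀ n, 1 ≤ n → 0 < η n) (henv : IsStochConstrained P ℓ gap)
    (hrun : IsRun P ℓ len η I p) (best : Fin K) {n : ℕ} (hn : 1 ≤ n) :
    meanRoot P p best n = ∑ i ∈ Finset.univ.erase best, ∫ ω, √(p n ω i) ∂P :=
  integral_finsetSum _ fun i _ => integrable_root hη henv hrun hn i

theorem meanRoot_nonneg (best : Fin K) (n : ℕ) : 0 ≤ meanRoot P p best n :=
  integral_nonneg fun _ => Finset.sum_nonneg fun _ _ => Real.sqrt_nonneg _

theorem meanProb_le_integral_root (hη : ∀ n, 1 ≤ n → 0 < η n)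
    (henv : IsStochConstrained P ℓ gap) (hrun : IsRun P ℓ len η I p) {n : ℕ} (hn : 1 ≤ n)
    (i : Fin K) : meanProb P p n i ≤ ∫ ω, √(p n ω i) ∂P := by
  refine integral_mono (integrable_distribution hη henv hrun hn i)
    (integrable_root hη henv hrun hn i) fun ω => ?_
  have hs := hrun.mem_simplex n hn ω
  exact Real.le_sqrt_of_sq_le (by nlinarith [hs.1 i, simplex_le_one hs i])

/-- The crude bound suffices because it is used for the last block only, which has no counterpart in
the regret to absorb it. -/
theorem meanRoot_le (hη : ∀ n, 1 ≤ n → 0 < η n) (henv : IsStochConstrained P ℓ gap)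
    (hrun : IsRun P ℓ len η I p) (best : Fin K) {n : ℕ} (hn : 1 ≤ n) :
    meanRoot P p best n ≤ K := by
  rw [meanRoot_eq_sum hη henv hrun best hn]
  refine (Finset.sum_le_card_nsmul _ _ 1 fun i _ => ?_).trans ?_
  · calc ∫ ω, √(p n ω i) ∂P ≤ ∫ _, (1 : ℝ) ∂P :=
          integral_mono (integrable_root hη henv hrun hn i) (integrable_const 1)
            fun ω => Real.sqrt_le_one.2 (simplex_le_one (hrun.mem_simplex n hn ω) i)
      _ = 1 := by simp
  · rw [nsmul_eq_mul, mul_one]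
    exact_mod_cast (Finset.card_le_univ _).trans (by simp)

/-- Self-bounding: a multiple of the sum of roots is absorbed by a multiple of the regret. -/
theorem mul_meanRoot_sub_le (hη : ∀ n, 1 ≤ n → 0 < η n) (henv : IsStochConstrained P ℓ gap)
    (hrun : IsRun P ℓ len η I p) {best : Fin K} (hbest : ∀ i, i ≠ best → 0 < subopt gap i)
    {n : ℕ} (hn : 1 ≤ n) {L : ℝ} (hL : 0 < L) (c : ℝ) :
    c * meanRoot P p best n - L * ∑ i, subopt gap i * meanProb P p n i
      ≤ ∑ i ∈ Finset.univ.erase best, c ^ 2 / (4 * subopt gap i * L) := by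
  rw [meanRoot_eq_sum hη henv hrun best hn, ← Finset.add_sum_erase _ _ (Finset.mem_univ best),
    subopt_best henv hbest, zero_mul, zero_add, Finset.mul_sum, Finset.mul_sum,
    ← Finset.sum_sub_distrib]
  refine Finset.sum_le_sum fun i hi => ?_
  have hΔ := hbest i (Finset.ne_of_mem_erase hi)
  rw [meanProb, ← mul_assoc, ← integral_const_mul, ← integral_const_mul, ← integral_sub
    ((integrable_root hη henv hrun hn i).const_mul _)
    ((integrable_distribution hη henv hrun hn i).const_mul _)]
  calc ∫ ω, c * √(p n ω i) - L * subopt gap i * p n ω i ∂P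
      ≤ ∫ _, c ^ 2 / (4 * subopt gap i * L) ∂P := by
        refine integral_mono (((integrable_root hη henv hrun hn i).const_mul _).sub
          ((integrable_distribution hη henv hrun hn i).const_mul _)) (integrable_const _)
          fun ω => ?_
        have hsq := Real.sq_sqrt ((hrun.mem_simplex n hn ω).1 i)
        change c * √(p n ω i) - L * subopt gap i * p n ω i ≤ c ^ 2 / (4 * subopt gap i * L)
        generalize √(p n ω i) = r at hsq ⊢
        rw [le_div_iff₀ (by positivity), ← hsq]
        -- Completion of the square in r = √p: c r - LΔ r² is largest at r = c / (2LΔ).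
        nlinarith [sq_nonneg (c - 2 * (L * subopt gap i) * r)]
    _ = _ := by simp

end Regret

/-! ### Expected regret over the blocks and switching cost -/

section RegretBounds

set_option linter.unusedSectionVars false

variable {K : ℕ} [NeZero K] {Ω : Type*} [mΩ : MeasurableSpace Ω] {P : Measure Ω}
  [IsProbabilityMeasure P] {ℓ : ℕ → Ω → Fin K → ℝ} {gap : Fin K → Fin K → ℝ} {len : ℕ → ℕ}
  {η : ℕ → ℝ} {I : ℕ → Ω → Fin K} {p : ℕ → Ω → Fin K → ℝ}

theorem integral_blockLoss (henv : IsStochConstrained P ℓ gap) {n : ℕ} (i : Fin K) :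
    ∫ ω, blockLoss ℓ len n ω i ∂P
      = ∑ t ∈ Finset.Ioc (blockEnd len (n - 1)) (blockEnd len n), ∫ ω, ℓ t ω i ∂P :=
  integral_finsetSum _ fun t ht => integrable_loss henv
    (by have := (Finset.mem_Ioc.1 ht).1; omega) i

theorem measurable_blockLoss_all {n : ℕ} (i : Fin K) :
    Measurable[lossesAndPastActions ℓ I n] fun ω => blockLoss ℓ len n ω i :=
  @measurable_blockLoss K Ω (lossesAndPastActions ℓ I n) ℓ len n
    (fun _ ht _ => measurable_loss_all ht) i

theorem abs_blockLoss_le (henv : IsStochConstrained P ℓ gap) {n : ℕ} (hn : 1 ≤ n) (ω : Ω)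
    (i : Fin K) : |blockLoss ℓ len n ω i| ≤ len n := by
  have := blockLoss_mem (len := len) henv hn ω i
  rw [abs_of_nonneg this.1]
  exact this.2

theorem measurable_lossEstimate_apply (hη : ∀ n, 1 ≤ n → 0 < η n)
    (henv : IsStochConstrained P ℓ gap) (hrun : IsRun P ℓ len η I p) {n : ℕ} (hn : 1 ≤ n)
    (i : Fin K) : Measurable fun ω => lossEstimate ℓ len I p n ω i :=
  measurable_lossEstimate (fun t ht _ => henv.measurable_loss t ht)
    (hrun.measurable_action n hn)
    (measurable_pi_lambda _ fun i => measurable_distribution_apply hη henv hrun hn i) i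

theorem abs_lossEstimate_le (henv : IsStochConstrained P ℓ gap) {n : ℕ} (hn : 1 ≤ n) {δ : ℝ}
    (hδ : 0 < δ) {ω : Ω} {i : Fin K} (h : δ ≤ p n ω i) :
    |lossEstimate ℓ len I p n ω i| ≤ len n / δ := by
  unfold lossEstimate
  split_ifs
  · rw [abs_div, abs_of_pos (hδ.trans_le h)]
    exact div_le_div₀ (by positivity) (abs_blockLoss_le henv hn ω i) hδ h
  · rw [abs_zero]; positivity

/-- The loss estimates are unbiased. -/
theorem integral_lossEstimate (hη : ∀ n, 1 ≤ n → 0 < η n) (henv : IsStochConstrained P ℓ gap)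
    (hrun : IsRun P ℓ len η I p) {n : ℕ} (hn : 1 ≤ n) (i : Fin K) :
    ∫ ω, lossEstimate ℓ len I p n ω i ∂P = ∫ ω, blockLoss ℓ len n ω i ∂P := by
  obtain ⟨δ, hδ, hδp⟩ := distribution_lower_bound hη henv hrun hn
  have hm : Measurable[lossesAndPastActions ℓ I n]
      fun ω => blockLoss ℓ len n ω i / p n ω i :=
    Measurable.div (measurable_blockLoss_all i) (measurable_distribution_all hη hrun hn i)
  have h := integral_mul_action henv hrun hn i hm (B := len n / δ) fun ω => by
    rw [abs_div, abs_of_pos (hδ.trans_le (hδp ω i))]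
    exact div_le_div₀ (by positivity) (abs_blockLoss_le henv hn ω i) hδ (hδp ω i)
  calc ∫ ω, lossEstimate ℓ len I p n ω i ∂P
      = ∫ ω, blockLoss ℓ len n ω i / p n ω i * (if I n ω = i then 1 else 0) ∂P := by
        refine integral_congr_ae (Eventually.of_forall fun ω => ?_)
        simp [lossEstimate]
    _ = ∫ ω, blockLoss ℓ len n ω i / p n ω i * p n ω i ∂P := h
    _ = _ := by
        refine integral_congr_ae (Eventually.of_forall fun ω => ?_)
        exact div_mul_cancel₀ _ (hδ.trans_le (hδp ω i)).ne'

theorem sum_mul_lossEstimate (hη : ∀ n, 1 ≤ n → 0 < η n) (hrun : IsRun P ℓ len η I p) {n : ℕ}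
    (hn : 1 ≤ n) (ω : Ω) :
    ∑ i, p n ω i * lossEstimate ℓ len I p n ω i = blockLoss ℓ len n ω (I n ω) := by
  simp only [lossEstimate, mul_ite, mul_zero, Finset.sum_ite_eq, Finset.mem_univ, if_true]
  exact mul_div_cancel₀ _ (distribution_pos hη hrun hn ω _).ne'

theorem integrable_played_blockLoss (henv : IsStochConstrained P ℓ gap)
    (hrun : IsRun P ℓ len η I p) {n : ℕ} (hn : 1 ≤ n) :
    Integrable (fun ω => blockLoss ℓ len n ω (I n ω)) P :=
  integrable_finsetSum _ fun t ht =>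
    integrable_played_loss henv hrun (by have := (Finset.mem_Ioc.1 ht).1; omega) hn

theorem integrable_lossEstimate (hη : ∀ n, 1 ≤ n → 0 < η n) (henv : IsStochConstrained P ℓ gap)
    (hrun : IsRun P ℓ len η I p) {n : ℕ} (hn : 1 ≤ n) (i : Fin K) :
    Integrable (fun ω => lossEstimate ℓ len I p n ω i) P := by
  obtain ⟨δ, hδ, hδp⟩ := distribution_lower_bound hη henv hrun hn
  exact integrable_of_abs_le (measurable_lossEstimate_apply hη henv hrun hn i)
    fun ω => abs_lossEstimate_le henv hn hδ (hδp ω i)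

/-- The expected regret over a block, in terms of the estimates. -/
theorem integral_block_regret (hη : ∀ n, 1 ≤ n → 0 < η n)
    (henv : IsStochConstrained P ℓ gap) (hrun : IsRun P ℓ len η I p) {best : Fin K}
    (hbest : ∀ i, i ≠ best → 0 < subopt gap i) {n : ℕ} (hn : 1 ≤ n) :
    ∫ ω, (∑ i, p n ω i * lossEstimate ℓ len I p n ω i - lossEstimate ℓ len I p n ω best) ∂P
      = len n * ∑ i, subopt gap i * meanProb P p n i := by
  simp_rw [sum_mul_lossEstimate hη hrun hn]
  rw [integral_sub (integrable_played_blockLoss henv hrun hn)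
    (integrable_lossEstimate hη henv hrun hn best), integral_lossEstimate hη henv hrun hn,
    integral_blockLoss henv]
  have h1 : ∫ ω, blockLoss ℓ len n ω (I n ω) ∂P
      = ∑ t ∈ Finset.Ioc (blockEnd len (n - 1)) (blockEnd len n), ∫ ω, ℓ t ω (I n ω) ∂P :=
    integral_finsetSum _ fun t ht =>
      integrable_played_loss henv hrun (by have := (Finset.mem_Ioc.1 ht).1; omega) hn
  rw [h1, ← Finset.sum_sub_distrib, Finset.sum_congr rfl fun t ht =>
    integral_played_loss_sub hη henv hrun hbest hn (Finset.mem_Ioc.1 ht).1,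
    Finset.sum_const, card_block len hn, nsmul_eq_mul]

/-- The stability term of block `n`. -/
noncomputable def blockStability {K : ℕ} {Ω : Type*} (ℓ : ℕ → Ω → Fin K → ℝ) (len : ℕ → ℕ)
    (η : ℕ → ℝ) (I : ℕ → Ω → Fin K) (p : ℕ → Ω → Fin K → ℝ) (n : ℕ) (ω : Ω) : ℝ :=
  stability (η n) (p n ω) (p (n + 1) ω) (lossEstimate ℓ len I p n ω)

theorem integrable_blockStability (hη : ∀ n, 1 ≤ n → 0 < η n)
    (henv : IsStochConstrained P ℓ gap) (hrun : IsRun P ℓ len η I p) {n : ℕ} (hn : 1 ≤ n) :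
    Integrable (blockStability ℓ len η I p n) P := by
  obtain ⟨δ, hδ, hδp⟩ := distribution_lower_bound hη henv hrun hn
  have hmp := fun i => measurable_distribution_apply hη henv hrun hn i
  have hmq := fun i => measurable_distribution_apply hη henv hrun (n := n + 1) (by omega) i
  have hmc := fun i => measurable_lossEstimate_apply hη henv hrun hn i
  have hs := fun ω => hrun.mem_simplex n hn ω
  have hs' := fun ω => hrun.mem_simplex (n + 1) (by omega) ω
  unfold blockStability stability bregman
  refine (integrable_finsetSum _ fun i _ => ?_).sub
    ((integrable_finsetSum _ fun i _ => ?_).const_mul _)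
  · refine integrable_of_abs_le (B := 1 * (len n / δ)) (((hmp i).sub (hmq i)).mul (hmc i))
      fun ω => ?_
    rw [abs_mul]
    refine mul_le_mul ?_ (abs_lossEstimate_le henv hn hδ (hδp ω i)) (abs_nonneg _) zero_le_one
    rw [abs_le]
    constructor <;> linarith [(hs ω).1 i, (hs' ω).1 i, simplex_le_one (hs ω) i,
      simplex_le_one (hs' ω) i]
  · refine integrable_of_abs_le (B := 2 * 1 / √δ)
      ((((hmq i).sqrt.sub (hmp i).sqrt).pow_const 2).const_mul 2 |>.div (hmp i).sqrt)
      fun ω => ?_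
    rw [abs_of_nonneg (by positivity)]
    have h1 : (√(p (n + 1) ω i) - √(p n ω i)) ^ 2 ≤ 1 := by
      have e1 := Real.sqrt_le_one.2 (simplex_le_one (hs ω) i)
      have e2 := Real.sqrt_le_one.2 (simplex_le_one (hs' ω) i)
      have e3 := Real.sqrt_nonneg (p n ω i)
      have e4 := Real.sqrt_nonneg (p (n + 1) ω i)
      rw [sq_le_one_iff_abs_le_one, abs_le]
      constructor <;> linarith
    have h2 : √δ ≤ √(p n ω i) := Real.sqrt_le_sqrt (hδp ω i)
    have h3 : 0 < √δ := Real.sqrt_pos.2 hδ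
    gcongr

theorem blockStability_le_len (hη : ∀ n, 1 ≤ n → 0 < η n)
    (henv : IsStochConstrained P ℓ gap) (hrun : IsRun P ℓ len η I p) {n : ℕ} (hn : 1 ≤ n)
    (ω : Ω) : blockStability ℓ len η I p n ω ≤ len n := by
  refine (stability_le_of_nonneg (hη n hn) (hrun.mem_simplex (n + 1) (by omega) ω)
    (lossEstimate_nonneg henv hrun hn ω)).trans ?_
  rw [sum_mul_lossEstimate hη hrun hn]
  exact (blockLoss_mem henv hn ω _).2

/-- The shift is the observed block loss x. Since 0 ≤ x ≤ |B_n|, the condition of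
`stability_le_of_shift` follows from η_n |B_n| ≤ 1. The squares are expanded so that the action
enters only through its indicator, ready for averaging over the draw. -/
theorem blockStability_le (hη : ∀ n, 1 ≤ n → 0 < η n)
    (henv : IsStochConstrained P ℓ gap) (hrun : IsRun P ℓ len η I p) {n : ℕ} (hn : 1 ≤ n)
    (hlen : η n * len n ≤ 1) (ω : Ω) :
    blockStability ℓ len η I p n ω ≤ η n * len n ^ 2 * ∑ i,
      (√(p n ω i) ^ 3 * (1 / p n ω i ^ 2 - 2 / p n ω i) * (if I n ω = i then 1 else 0)
        + √(p n ω i) ^ 3) := by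
  have hpos := distribution_pos hη hrun hn ω
  have hs := hrun.mem_simplex n hn ω
  have hηn := hη n hn
  obtain ⟨hx0, hx1⟩ := blockLoss_mem (len := len) henv hn ω (I n ω)
  set x := blockLoss ℓ len n ω (I n ω) with hx
  refine (stability_le_of_shift hηn hs hpos (hrun.mem_simplex (n + 1) (by omega) ω) x
    fun i => ?_).trans ?_
  · have h1 := lossEstimate_nonneg henv hrun hn ω i
    have h2 : √(p n ω i) ≤ 1 := Real.sqrt_le_one.2 (simplex_le_one hs i)
    have h3 := Real.sqrt_nonneg (p n ω i)
    have h4 : η n * √(p n ω i) * x ≤ 1 := by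
      calc η n * √(p n ω i) * x ≤ η n * 1 * len n := by gcongr
        _ ≤ 1 := by rw [mul_one]; exact hlen
    have h5 : 0 ≤ η n * √(p n ω i) * lossEstimate ℓ len I p n ω i := by positivity
    linarith [mul_sub (η n * √(p n ω i)) (lossEstimate ℓ len I p n ω i) x]
  · rw [Finset.mul_sum]
    refine Finset.sum_le_sum fun i _ => ?_
    have h3 := Real.sqrt_nonneg (p n ω i)
    have hxsq : x ^ 2 ≤ (len n : ℝ) ^ 2 := by gcongr
    unfold lossEstimate
    by_cases hI : I n ω = i
    · rw [if_pos hI, if_pos hI, ← hI, ← hx]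
      have hne := (hpos (I n ω)).ne'
      have : η n * (√(p n ω (I n ω)) ^ 3 * (x / p n ω (I n ω) - x) ^ 2)
          = η n * x ^ 2 * (√(p n ω (I n ω)) ^ 3 * (1 / p n ω (I n ω) - 1) ^ 2) := by
        field_simp
      rw [this]
      have e : √(p n ω (I n ω)) ^ 3 * (1 / p n ω (I n ω) ^ 2 - 2 / p n ω (I n ω)) * 1
          + √(p n ω (I n ω)) ^ 3 = √(p n ω (I n ω)) ^ 3 * (1 / p n ω (I n ω) - 1) ^ 2 := by
        field_simp
        ring
      rw [e]
      gcongr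
    · rw [if_neg hI, if_neg hI, mul_zero, zero_add, zero_sub, neg_sq]
      calc η n * (√(p n ω i) ^ 3 * x ^ 2) = η n * x ^ 2 * √(p n ω i) ^ 3 := by ring
        _ ≤ η n * len n ^ 2 * √(p n ω i) ^ 3 := by gcongr

/-- For the arm `b` the factor 1 - q_b is the mass of the other arms, which their roots dominate. -/
theorem sum_root_mul_one_sub_le {q : Fin K → ℝ} (hq : q ∈ stdSimplex ℝ (Fin K)) (b : Fin K) :
    ∑ i, √(q i) * (1 - q i) ≤ 2 * ∑ i ∈ Finset.univ.erase b, √(q i) := by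
  have hsum : 1 - q b = ∑ i ∈ Finset.univ.erase b, q i := by
    rw [← hq.2, ← Finset.add_sum_erase _ _ (Finset.mem_univ b)]; ring
  have hroot : ∀ i, q i ≤ √(q i) := fun i =>
    Real.le_sqrt_of_sq_le (by nlinarith [hq.1 i, simplex_le_one hq i])
  rw [← Finset.add_sum_erase _ _ (Finset.mem_univ b)]
  have h1 : √(q b) * (1 - q b) ≤ ∑ i ∈ Finset.univ.erase b, √(q i) := by
    calc √(q b) * (1 - q b) ≤ 1 * (1 - q b) := by
          gcongr
          · linarith [simplex_le_one hq b]
          · exact Real.sqrt_le_one.2 (simplex_le_one hq b)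
      _ = ∑ i ∈ Finset.univ.erase b, q i := by rw [one_mul, hsum]
      _ ≤ _ := Finset.sum_le_sum fun i _ => hroot i
  have h2 : ∑ i ∈ Finset.univ.erase b, √(q i) * (1 - q i)
      ≤ ∑ i ∈ Finset.univ.erase b, √(q i) :=
    Finset.sum_le_sum fun i _ => by nlinarith [hq.1 i, Real.sqrt_nonneg (q i)]
  linarith

theorem integral_blockStability_le (hη : ∀ n, 1 ≤ n → 0 < η n)
    (henv : IsStochConstrained P ℓ gap) (hrun : IsRun P ℓ len η I p) (best : Fin K) {n : ℕ}
    (hn : 1 ≤ n) (hlen : η n * len n ≤ 1) :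
    ∫ ω, blockStability ℓ len η I p n ω ∂P ≤ 2 * (η n * len n ^ 2) * meanRoot P p best n := by
  obtain ⟨δ, hδ, hδp⟩ := distribution_lower_bound hη henv hrun hn
  have hs := fun ω => hrun.mem_simplex n hn ω
  have hle := lossesAndPastActions_le henv hrun n
  have hmp := fun i => measurable_distribution_all hη hrun hn i
  let w : Fin K → Ω → ℝ := fun i ω => √(p n ω i) ^ 3 * (1 / p n ω i ^ 2 - 2 / p n ω i)
  have hwm : ∀ i, Measurable[lossesAndPastActions ℓ I n] (w i) := fun i =>
    Measurable.mul (Measurable.pow_const (Measurable.sqrt (hmp i)) 3)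
      (Measurable.sub (Measurable.div measurable_const (Measurable.pow_const (hmp i) 2))
        (Measurable.div measurable_const (hmp i)))
  have hroot : ∀ i ω, |√(p n ω i) ^ 3| ≤ 1 := fun i ω => by
    rw [abs_of_nonneg (by positivity)]
    exact pow_le_one₀ (Real.sqrt_nonneg _) (Real.sqrt_le_one.2 (simplex_le_one (hs ω) i))
  have hwb : ∀ i ω, |w i ω| ≤ 1 / δ ^ 2 + 2 / δ := fun i ω => by
    have hp := hδp ω i
    have hp0 := hδ.trans_le hp
    have h1 : |1 / p n ω i ^ 2 - 2 / p n ω i| ≤ 1 / δ ^ 2 + 2 / δ := by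
      refine (abs_sub _ _).trans ?_
      rw [abs_of_pos (by positivity), abs_of_pos (by positivity)]
      gcongr
    rw [abs_mul]
    calc _ ≤ 1 * (1 / δ ^ 2 + 2 / δ) :=
          mul_le_mul (hroot i ω) h1 (abs_nonneg _) zero_le_one
      _ = _ := one_mul _
  have hint1 : ∀ i, Integrable (fun ω => w i ω * (if I n ω = i then 1 else 0)) P := fun i =>
    integrable_of_abs_le (B := (1 / δ ^ 2 + 2 / δ) * 1) (((hwm i).mono hle le_rfl).mul
      (measurable_action_apply hrun hn i)) fun ω => by
        rw [abs_mul]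
        exact mul_le_mul (hwb i ω) (abs_action_le n i ω) (abs_nonneg _) (by positivity)
  have hint2 : ∀ i, Integrable (fun ω => √(p n ω i) ^ 3) P := fun i =>
    integrable_of_abs_le (((hmp i).mono hle le_rfl).sqrt.pow_const 3) (hroot i)
  have hint3 : ∀ i, Integrable (fun ω => w i ω * p n ω i) P := fun i =>
    integrable_of_abs_le (B := (1 / δ ^ 2 + 2 / δ) * 1) (((hwm i).mul (hmp i)).mono hle le_rfl)
      fun ω => by
        rw [abs_mul]
        refine mul_le_mul (hwb i ω) ?_ (abs_nonneg _) (by positivity)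
        rw [abs_of_nonneg ((hs ω).1 i)]
        exact simplex_le_one (hs ω) i
  have hint12 : ∀ i, Integrable
      (fun ω => w i ω * (if I n ω = i then 1 else 0) + √(p n ω i) ^ 3) P :=
    fun i => (hint1 i).add (hint2 i)
  have hint32 : ∀ i, Integrable (fun ω => w i ω * p n ω i + √(p n ω i) ^ 3) P :=
    fun i => (hint3 i).add (hint2 i)
  have hηn := hη n hn
  calc ∫ ω, blockStability ℓ len η I p n ω ∂P
      ≤ ∫ ω, η n * len n ^ 2 * ∑ i,
          (w i ω * (if I n ω = i then 1 else 0) + √(p n ω i) ^ 3) ∂P :=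
        integral_mono (integrable_blockStability hη henv hrun hn)
          ((integrable_finsetSum _ fun i _ => hint12 i).const_mul _)
          (blockStability_le hη henv hrun hn hlen)
    _ = η n * len n ^ 2 * ∑ i, ∫ ω, (w i ω * p n ω i + √(p n ω i) ^ 3) ∂P := by
        rw [integral_const_mul, integral_finsetSum _ fun i _ => hint12 i]
        congr 1
        refine Finset.sum_congr rfl fun i _ => ?_
        rw [integral_add (hint1 i) (hint2 i), integral_add (hint3 i) (hint2 i),
          integral_mul_action henv hrun hn i (hwm i) (hwb i)]
    -- Averaging replaces the indicator by p, and p^{3/2}(1/p² - 2/p) p + p^{3/2} = √p (1 - p).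
    _ = η n * len n ^ 2 * ∫ ω, ∑ i, √(p n ω i) * (1 - p n ω i) ∂P := by
        rw [← integral_finsetSum _ fun i _ => hint32 i]
        congr 1
        refine integral_congr_ae (Eventually.of_forall fun ω => Finset.sum_congr rfl fun i _ => ?_)
        have hp := hδ.trans_le (hδp ω i)
        have h2 := Real.sq_sqrt hp.le
        have h1 : 0 < √(p n ω i) := Real.sqrt_pos.2 hp
        simp only [w]
        generalize √(p n ω i) = a at *
        rw [← h2]
        field_simp
        ring
    _ ≤ η n * len n ^ 2 * (2 * meanRoot P p best n) := by
        gcongr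
        rw [meanRoot, ← integral_const_mul]
        refine integral_mono (integrable_finsetSum _ fun i _ => ?_)
          ((integrable_finsetSum _ fun i _ => integrable_root hη henv hrun hn i).const_mul _)
          fun ω => sum_root_mul_one_sub_le (hs ω) best
        refine integrable_of_abs_le (B := 1) (((hmp i).mono hle le_rfl).sqrt.mul
          (measurable_const.sub ((hmp i).mono hle le_rfl))) fun ω => ?_
        have h1 := (hs ω).1 i
        have h2 := simplex_le_one (hs ω) i
        rw [abs_mul, abs_of_nonneg (Real.sqrt_nonneg _), abs_of_nonneg (by linarith)]
        exact mul_le_one₀ (Real.sqrt_le_one.2 h2) (by linarith) (by linarith)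
    _ = _ := by ring

/-- The expected regret over the first `M` blocks. -/
theorem regret_blocks_le (hη : ∀ n, 1 ≤ n → 0 < η n) (hη0 : (η 0)⁻¹ = 0)
    (hmono : Monotone fun n => (η n)⁻¹) (henv : IsStochConstrained P ℓ gap)
    (hrun : IsRun P ℓ len η I p) {best : Fin K} (hbest : ∀ i, i ≠ best → 0 < subopt gap i)
    (M : ℕ) :
    ∑ n ∈ Finset.Icc 1 M, len n * ∑ i, subopt gap i * meanProb P p n i
      ≤ ∑ n ∈ Finset.Icc 1 M, (if η n * len n ≤ 1
          then 2 * (η n * len n ^ 2) * meanRoot P p best n else (len n : ℝ))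
        + ∑ n ∈ Finset.Icc 1 (M + 1),
          ((η n)⁻¹ - (η (n - 1))⁻¹) * (4 * meanRoot P p best n) := by
  have hpt : ∀ ω, ∑ n ∈ Finset.Icc 1 M,
      (∑ i, p n ω i * lossEstimate ℓ len I p n ω i - lossEstimate ℓ len I p n ω best)
      ≤ ∑ n ∈ Finset.Icc 1 M, blockStability ℓ len η I p n ω
        + ∑ n ∈ Finset.Icc 1 (M + 1),
          ((η n)⁻¹ - (η (n - 1))⁻¹) * (4 * ∑ i ∈ Finset.univ.erase best, √(p n ω i)) :=
    fun ω => ftrl_regret hη hη0 hmono (C := fun n => cumEstimate ℓ len I p n ω)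
      (p := fun n => p n ω) (c := fun n => lossEstimate ℓ len I p n ω)
      (by funext i; simp [cumEstimate]) (fun n i => cumEstimate_succ n ω i)
      (fun n hn => hrun.mem_simplex n hn ω) (fun n hn => hrun.isMinOn n hn ω) best M
  have h1 : ∀ n ∈ Finset.Icc 1 M, Integrable (fun ω =>
      ∑ i, p n ω i * lossEstimate ℓ len I p n ω i - lossEstimate ℓ len I p n ω best) P := by
    intro n hn
    have hn := (Finset.mem_Icc.1 hn).1
    simp_rw [sum_mul_lossEstimate hη hrun hn]
    exact (integrable_played_blockLoss henv hrun hn).sub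
      (integrable_lossEstimate hη henv hrun hn best)
  have h2 : ∀ n ∈ Finset.Icc 1 M, Integrable (blockStability ℓ len η I p n) P :=
    fun n hn => integrable_blockStability hη henv hrun (Finset.mem_Icc.1 hn).1
  have h3 : ∀ n ∈ Finset.Icc 1 (M + 1), Integrable (fun ω =>
      ((η n)⁻¹ - (η (n - 1))⁻¹) * (4 * ∑ i ∈ Finset.univ.erase best, √(p n ω i))) P :=
    fun n hn => ((integrable_finsetSum _ fun i _ =>
      integrable_root hη henv hrun (Finset.mem_Icc.1 hn).1 i).const_mul _).const_mul _
  have hint := integral_mono (integrable_finsetSum _ h1)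
    ((integrable_finsetSum _ h2).add (integrable_finsetSum _ h3)) hpt
  rw [integral_finsetSum _ h1] at hint
  have hadd : ∫ ω, (∑ n ∈ Finset.Icc 1 M, blockStability ℓ len η I p n ω
        + ∑ n ∈ Finset.Icc 1 (M + 1),
          ((η n)⁻¹ - (η (n - 1))⁻¹) * (4 * ∑ i ∈ Finset.univ.erase best, √(p n ω i))) ∂P
      = ∑ n ∈ Finset.Icc 1 M, ∫ ω, blockStability ℓ len η I p n ω ∂P
        + ∑ n ∈ Finset.Icc 1 (M + 1),
          ((η n)⁻¹ - (η (n - 1))⁻¹) * (4 * meanRoot P p best n) := by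
    rw [integral_add (integrable_finsetSum _ h2) (integrable_finsetSum _ h3),
      integral_finsetSum _ h2, integral_finsetSum _ h3]
    simp only [integral_const_mul, meanRoot]
  rw [Finset.sum_congr rfl fun n hn =>
    integral_block_regret hη henv hrun hbest (Finset.mem_Icc.1 hn).1] at hint
  refine (hint.trans_eq hadd).trans (add_le_add_left (Finset.sum_le_sum fun n hn => ?_) _)
  have hn1 := (Finset.mem_Icc.1 hn).1
  split_ifs with hlen
  · exact integral_blockStability_le hη henv hrun best hn1 hlen
  · calc ∫ ω, blockStability ℓ len η I p n ω ∂P ≤ ∫ _, (len n : ℝ) ∂P :=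
          integral_mono (h2 n hn) (integrable_const _) (blockStability_le_len hη henv hrun hn1)
      _ = _ := by simp

/-- The pseudo-regret, with a trivial bound for the last block. -/
theorem pseudoRegret_le (hη : ∀ n, 1 ≤ n → 0 < η n) (henv : IsStochConstrained P ℓ gap)
    (hrun : IsRun P ℓ len η I p) {best : Fin K} (hbest : ∀ i, i ≠ best → 0 < subopt gap i)
    {T M : ℕ} (hMT : blockEnd len M < T) (hTM : T ≤ blockEnd len (M + 1)) :
    pseudoRegret P ℓ len I T
      ≤ ∑ n ∈ Finset.Icc 1 M, len n * ∑ i, subopt gap i * meanProb P p n i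
        + len (M + 1) := by
  have hof : ∀ n, 1 ≤ n → ∀ t ∈ Finset.Ioc (blockEnd len (n - 1)) (blockEnd len n),
      blockOf len t = n := by
    intro n hn t ht
    obtain ⟨m, rfl⟩ : ∃ m, n = m + 1 := ⟨n - 1, by omega⟩
    rw [Finset.mem_Ioc] at ht
    exact blockOf_eq ht.1 ht.2
  have hblock : ∀ t ∈ Finset.Icc 1 T, ∃ m, blockOf len t = m + 1 ∧ blockEnd len m < t := by
    intro t ht
    obtain ⟨ht1, htT⟩ := Finset.mem_Icc.1 ht
    have hmem : t ≤ blockEnd len (blockOf len t) :=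
      Nat.sInf_mem (s := {n : ℕ | t ≤ blockEnd len n}) ⟨M + 1, htT.trans hTM⟩
    obtain ⟨m, hm⟩ : ∃ m, blockOf len t = m + 1 := by
      refine ⟨blockOf len t - 1, (Nat.succ_pred_eq_of_ne_zero fun h => ?_).symm⟩
      rw [h] at hmem
      simp [blockEnd] at hmem
      omega
    refine ⟨m, hm, ?_⟩
    by_contra! h
    have : blockOf len t ≤ m := Nat.sInf_le h
    omega
  set v : ℕ → ℝ := fun t => ∑ i, subopt gap i * meanProb P p (blockOf len t) i with hv
  have hvt : ∀ t ∈ Finset.Icc 1 T,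
      ∫ ω, ℓ t ω (I (blockOf len t) ω) ∂P - ∫ ω, ℓ t ω best ∂P = v t := by
    intro t ht
    obtain ⟨m, hm, hmt⟩ := hblock t ht
    simp only [hv, hm]
    exact integral_played_loss_sub hη henv hrun hbest (by omega) (by simpa using hmt)
  have hv1 : ∀ t ∈ Finset.Icc 1 T, v t ≤ 1 := by
    intro t ht
    obtain ⟨m, hm, -⟩ := hblock t ht
    simp only [hv, hm]
    rw [← sum_meanProb hη henv hrun (n := m + 1) (by omega)]
    exact Finset.sum_le_sum fun i _ => mul_le_of_le_one_left
      (meanProb_nonneg hrun (by omega) i) (subopt_le_one henv hbest i)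
  have hreg : pseudoRegret P ℓ len I T ≤ ∑ t ∈ Finset.Icc 1 T, v t := by
    have h1 : ∫ ω, ∑ t ∈ Finset.Icc 1 T, ℓ t ω (I (blockOf len t) ω) ∂P
        = ∑ t ∈ Finset.Icc 1 T, ∫ ω, ℓ t ω (I (blockOf len t) ω) ∂P :=
      integral_finsetSum _ fun t ht => by
        obtain ⟨m, hm, -⟩ := hblock t ht
        exact integrable_played_loss henv hrun (Finset.mem_Icc.1 ht).1 (by omega)
    have h2 : ∀ i, ∫ ω, ∑ t ∈ Finset.Icc 1 T, ℓ t ω i ∂P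
        = ∑ t ∈ Finset.Icc 1 T, ∫ ω, ℓ t ω i ∂P := fun i =>
      integral_finsetSum _ fun t ht => integrable_loss henv (Finset.mem_Icc.1 ht).1 i
    -- The arm `best` has the smallest mean loss in every single round, so it minimizes the
    -- cumulative loss.
    have h3 : ∑ t ∈ Finset.Icc 1 T, ∫ ω, ℓ t ω best ∂P
        ≤ ⨅ i : Fin K, ∫ ω, ∑ t ∈ Finset.Icc 1 T, ℓ t ω i ∂P := by
      refine le_ciInf fun i => ?_
      rw [h2]
      refine Finset.sum_le_sum fun t ht => ?_
      have e1 := integral_loss_sub henv (Finset.mem_Icc.1 ht).1 i best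
      have e2 := subopt_nonneg henv hbest i
      rw [← gap_best_eq_subopt henv hbest i] at e2
      linarith
    rw [← Finset.sum_congr rfl hvt, Finset.sum_sub_distrib, pseudoRegret, h1]
    linarith
  have hsplit : ∑ t ∈ Finset.Icc 1 T, v t
      = ∑ t ∈ Finset.Ioc 0 (blockEnd len M), v t
        + ∑ t ∈ Finset.Ioc (blockEnd len M) T, v t := by
    rw [Finset.sum_Ioc_consecutive v (Nat.zero_le _) hMT.le]
    rfl
  have hfirst : ∑ t ∈ Finset.Ioc 0 (blockEnd len M), v t
      = ∑ n ∈ Finset.Icc 1 M, len n * ∑ i, subopt gap i * meanProb P p n i := by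
    rw [sum_Ioc_blockEnd]
    refine Finset.sum_congr rfl fun n hn => ?_
    have hn1 := (Finset.mem_Icc.1 hn).1
    rw [Finset.sum_congr rfl fun t ht =>
        show v t = ∑ i, subopt gap i * meanProb P p n i by simp only [hv, hof n hn1 t ht],
      Finset.sum_const, card_block len hn1, nsmul_eq_mul]
  -- The last block may be cut by the horizon, in which case the estimates of the full block do not
  -- apply. Each of its rounds costs at most 1.
  have hlast : ∑ t ∈ Finset.Ioc (blockEnd len M) T, v t ≤ len (M + 1) := by
    refine (Finset.sum_le_card_nsmul _ _ 1 fun t ht => hv1 t ?_).trans ?_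
    · rw [Finset.mem_Ioc] at ht
      exact Finset.mem_Icc.2 ⟨by omega, ht.2⟩
    · rw [nsmul_eq_mul, mul_one, Nat.card_Ioc, Nat.cast_le]
      rw [blockEnd_succ] at hTM
      omega
  linarith

theorem prob_ne_best_le (hη : ∀ n, 1 ≤ n → 0 < η n) (henv : IsStochConstrained P ℓ gap)
    (hrun : IsRun P ℓ len η I p) (best : Fin K) {n : ℕ} (hn : 1 ≤ n) :
    P.real {ω | I n ω ≠ best} ≤ meanRoot P p best n := by
  have hset : {ω | I n ω ≠ best} = ⋃ i ∈ Finset.univ.erase best, {ω | I n ω = i} := by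
    ext ω; simp
  rw [hset, meanRoot_eq_sum hη henv hrun best hn]
  refine (measureReal_biUnion_finset_le _ _).trans (Finset.sum_le_sum fun i _ => ?_)
  refine le_trans (le_of_eq ?_) (meanProb_le_integral_root hη henv hrun hn i)
  have hS : MeasurableSet {ω | I n ω = i} :=
    hrun.measurable_action n hn (measurableSet_singleton i)
  rw [← integral_action henv hrun hn i, ← integral_indicator_one hS]
  refine integral_congr_ae (Eventually.of_forall fun ω => ?_)
  simp [Set.indicator_apply]

/-- If both blocks play `best`, there is no switch. -/
theorem prob_switch_le (hη : ∀ n, 1 ≤ n → 0 < η n) (henv : IsStochConstrained P ℓ gap)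
    (hrun : IsRun P ℓ len η I p) (best : Fin K) {n : ℕ} (hn : 1 ≤ n) :
    P.real {ω | actionOrNone I (n + 1) ω ≠ actionOrNone I n ω}
      ≤ meanRoot P p best n + meanRoot P p best (n + 1) := by
  have hsub : {ω | actionOrNone I (n + 1) ω ≠ actionOrNone I n ω}
      ⊆ {ω | I n ω ≠ best} ∪ {ω | I (n + 1) ω ≠ best} := by
    intro ω hω
    by_contra hcon
    simp only [Set.mem_union, Set.mem_ofPred_eq, not_or, not_not] at hcon
    apply hω
    simp [actionOrNone, hcon.1, hcon.2]
    omega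
  refine (measureReal_mono hsub).trans ((measureReal_union_le _ _).trans ?_)
  exact add_le_add (prob_ne_best_le hη henv hrun best hn)
    (prob_ne_best_le hη henv hrun best (by omega))

/-- Each block is charged for the switch into it and for the switch out of it, the last one only for
the former. The initial λ_1 is the forced switch at the first block. -/
theorem switchingCost_le (hη : ∀ n, 1 ≤ n → 0 < η n) (henv : IsStochConstrained P ℓ gap)
    (hrun : IsRun P ℓ len η I p) (best : Fin K) {lam : ℕ → ℝ} (hlam : ∀ n, 1 ≤ n → 0 ≤ lam n)
    {T M : ℕ} (hM : blockOf len T = M + 1) :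
    switchingCost P len lam I T
      ≤ lam 1 + ∑ n ∈ Finset.Icc 1 M, (lam n + lam (n + 1)) * meanRoot P p best n
        + lam (M + 1) * meanRoot P p best (M + 1) := by
  rw [switchingCost, hM]
  clear hM
  induction M with
  | zero =>
    have h1 : lam 1 * P.real {ω | actionOrNone I 1 ω ≠ actionOrNone I 0 ω} ≤ lam 1 :=
      mul_le_of_le_one_right (hlam 1 le_rfl) measureReal_le_one
    have h2 := mul_nonneg (hlam 1 le_rfl) (meanRoot_nonneg (P := P) (p := p) best 1)
    simp only [zero_add, Finset.Icc_self, Finset.sum_singleton, Nat.sub_self]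
    simp only [zero_lt_one, Finset.Icc_eq_empty_of_lt, Finset.sum_empty]
    linarith
  | succ M ih =>
    have h2 := Finset.sum_Icc_succ_top (a := 1) (b := M) (by omega)
      fun n => (lam n + lam (n + 1)) * meanRoot P p best n
    rw [Finset.sum_Icc_succ_top (by omega), h2, Nat.add_sub_cancel]
    have h1 := mul_le_mul_of_nonneg_left
      (prob_switch_le hη henv hrun best (n := M + 1) (by omega)) (hlam (M + 1 + 1) (by omega))
    linarith

end RegretBounds

/-! ### Block lengths and learning rates for power costs -/

/-- Bernoulli's inequality gives n^γ - (n-1)^γ ≤ γ n^{γ-1}, and this telescopes. -/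
theorem rpow_le_mul_sum_rpow {γ : ℝ} (hγ : 1 ≤ γ) (n : ℕ) :
    (n : ℝ) ^ γ ≤ γ * ∑ s ∈ Finset.Icc 1 n, (s : ℝ) ^ (γ - 1) := by
  induction n with
  | zero => simp [Real.zero_rpow (by linarith : γ ≠ 0)]
  | succ n ih =>
    rw [Finset.sum_Icc_succ_top (by omega), mul_add]
    have hx : (0 : ℝ) < (n + 1 : ℕ) := by positivity
    have hb := one_add_mul_self_le_rpow_one_add (s := -(1 / ((n + 1 : ℕ) : ℝ))) (by
      rw [neg_le_neg_iff, div_le_one hx]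
      push_cast
      linarith [(Nat.cast_nonneg n : (0 : ℝ) ≤ n)]) hγ
    have hn : (n : ℝ) = (n + 1 : ℕ) * (1 + -(1 / ((n + 1 : ℕ) : ℝ))) := by
      field_simp
      push_cast
      ring
    have hnn : 0 ≤ 1 + -(1 / ((n + 1 : ℕ) : ℝ)) := by
      have : 1 / ((n + 1 : ℕ) : ℝ) ≤ 1 := by
        rw [div_le_one hx]
        push_cast
        linarith [(Nat.cast_nonneg n : (0 : ℝ) ≤ n)]
      linarith
    have h1 : (n : ℝ) ^ γ
        = ((n + 1 : ℕ) : ℝ) ^ γ * (1 + -(1 / ((n + 1 : ℕ) : ℝ))) ^ γ := by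
      conv_lhs => rw [hn]
      exact Real.mul_rpow hx.le hnn
    have h2 : ((n + 1 : ℕ) : ℝ) ^ γ = (n + 1 : ℕ) * ((n + 1 : ℕ) : ℝ) ^ (γ - 1) := by
      rw [Real.rpow_sub_one hx.ne']
      field_simp
    have h3 := mul_le_mul_of_nonneg_left hb (Real.rpow_nonneg hx.le γ)
    rw [← h1] at h3
    have h4 : ((n + 1 : ℕ) : ℝ) ^ γ * (1 + γ * -(1 / ((n + 1 : ℕ) : ℝ)))
        = ((n + 1 : ℕ) : ℝ) ^ γ - γ * ((n + 1 : ℕ) : ℝ) ^ (γ - 1) := by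
      rw [h2]
      field_simp
      ring
    linarith

theorem sum_one_div_sqrt_le (n : ℕ) :
    ∑ s ∈ Finset.Icc 1 n, 1 / √(s : ℝ) ≤ 2 * √(n : ℝ) := by
  induction n with
  | zero => simp
  | succ n ih =>
    rw [Finset.sum_Icc_succ_top (by omega)]
    have hx : (0 : ℝ) < (n + 1 : ℕ) := by positivity
    have h1 := Real.sq_sqrt hx.le
    have h2 := Real.sq_sqrt (Nat.cast_nonneg n : (0 : ℝ) ≤ n)
    have h3 : 0 < √((n + 1 : ℕ) : ℝ) := Real.sqrt_pos.2 hx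
    have h4 := Real.sqrt_nonneg (n : ℝ)
    have h5 : 1 / √((n + 1 : ℕ) : ℝ) ≤ 2 * (√((n + 1 : ℕ) : ℝ) - √(n : ℝ)) := by
      rw [div_le_iff₀ h3]
      have h6 : ((n + 1 : ℕ) : ℝ) = n + 1 := by push_cast; ring
      nlinarith [sq_nonneg (√((n + 1 : ℕ) : ℝ) - √(n : ℝ))]
    linarith

section PowerCosts

variable {α : ℝ} {lam : ℕ → ℝ} {K : ℕ}

theorem scale_zero : scale K lam 0 = 0 := by simp [scale]

theorem scale_succ (n : ℕ) : scale K lam (n + 1)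
    = scale K lam n + (lam (n + 1) + √((K : ℝ) / ((n + 1 : ℕ) : ℝ))) := by
  rw [scale, Finset.sum_Icc_succ_top (by omega), scale]

theorem one_le_lam (hα : 0 < α) (hlam : ∀ n : ℕ, 1 ≤ n → lam n = (n : ℝ) ^ α) {n : ℕ}
    (hn : 1 ≤ n) : 1 ≤ lam n := by
  rw [hlam n hn]
  exact Real.one_le_rpow (by exact_mod_cast hn) hα.le

theorem lam_succ_le (hα : 0 < α) (hlam : ∀ n : ℕ, 1 ≤ n → lam n = (n : ℝ) ^ α) {n : ℕ}
    (hn : 1 ≤ n) : lam (n + 1) ≤ 2 ^ α * lam n := by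
  rw [hlam n hn, hlam (n + 1) (by omega), ← Real.mul_rpow (by norm_num) (by positivity)]
  refine Real.rpow_le_rpow (by positivity) ?_ hα.le
  push_cast
  have : (1 : ℝ) ≤ n := by exact_mod_cast hn
  linarith

theorem rpow_succ_le_scale (hα : 0 < α) (hlam : ∀ n : ℕ, 1 ≤ n → lam n = (n : ℝ) ^ α) (n : ℕ) :
    (n : ℝ) ^ (α + 1) ≤ (α + 1) * scale K lam n := by
  refine (rpow_le_mul_sum_rpow (by linarith) n).trans ?_
  rw [scale, add_sub_cancel_right]
  gcongr with s hs
  rw [hlam s (Finset.mem_Icc.1 hs).1]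
  linarith [Real.sqrt_nonneg ((K : ℝ) / s)]

theorem sqrt_le_scale (hα : 0 < α) (hlam : ∀ n : ℕ, 1 ≤ n → lam n = (n : ℝ) ^ α) {n : ℕ}
    (hn : 1 ≤ n) : √(K * n : ℝ) ≤ scale K lam n := by
  have hn0 : (0 : ℝ) < n := by exact_mod_cast hn
  have h1 : ∑ _s ∈ Finset.Icc 1 n, √((K : ℝ) / n) ≤ scale K lam n := by
    refine Finset.sum_le_sum fun s hs => ?_
    obtain ⟨hs1, hsn⟩ := Finset.mem_Icc.1 hs
    have hs0 : (0 : ℝ) < s := by exact_mod_cast hs1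
    have hsn' : (s : ℝ) ≤ n := by exact_mod_cast hsn
    have h2 : √((K : ℝ) / n) ≤ √((K : ℝ) / s) := by gcongr
    linarith [one_le_lam hα hlam hs1]
  refine le_trans (le_of_eq ?_) h1
  rw [Finset.sum_const, Nat.card_Icc, nsmul_eq_mul, Nat.add_sub_cancel]
  have h3 : (K * n : ℝ) = (n : ℝ) ^ 2 * (K / n) := by field_simp
  rw [h3, Real.sqrt_mul (by positivity), Real.sqrt_sq hn0.le]

theorem scale_le (hα : 0 < α) (hlam : ∀ n : ℕ, 1 ≤ n → lam n = (n : ℝ) ^ α) {n : ℕ}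
    (hn : 1 ≤ n) : scale K lam n ≤ (n : ℝ) ^ (α + 1) + n * √(K : ℝ) := by
  have hn0 : (0 : ℝ) < n := by exact_mod_cast hn
  have h1 : scale K lam n ≤ ∑ _s ∈ Finset.Icc 1 n, ((n : ℝ) ^ α + √(K : ℝ)) := by
    refine Finset.sum_le_sum fun s hs => ?_
    obtain ⟨hs1, hsn⟩ := Finset.mem_Icc.1 hs
    have hs0 : (1 : ℝ) ≤ s := by exact_mod_cast hs1
    rw [hlam s hs1]
    gcongr
    exact div_le_self (Nat.cast_nonneg K) hs0
  refine h1.trans (le_of_eq ?_)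
  rw [Finset.sum_const, Nat.card_Icc, nsmul_eq_mul, Nat.add_sub_cancel,
    Real.rpow_add_one hn0.ne']
  ring

theorem scale_pos (hα : 0 < α) (hlam : ∀ n : ℕ, 1 ≤ n → lam n = (n : ℝ) ^ α) {n : ℕ}
    (hn : 1 ≤ n) : 0 < scale K lam n := by
  have h1 := rpow_succ_le_scale (K := K) hα hlam n
  have h2 : 0 < (n : ℝ) ^ (α + 1) := Real.rpow_pos_of_pos (by exact_mod_cast hn) _
  exact pos_of_mul_pos_right (h2.trans_le h1) (by linarith)

theorem sqrt_le_blockLen (n : ℕ) :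
    √(lam n * scale K lam n / (K : ℝ)) ≤ blockLen K lam n :=
  (Nat.le_ceil _).trans (by exact_mod_cast le_max_left _ _)

theorem blockLen_le_sqrt_add_one (n : ℕ) :
    (blockLen K lam n : ℝ) ≤ √(lam n * scale K lam n / (K : ℝ)) + 1 := by
  rw [blockLen, Nat.cast_max, Nat.cast_one]
  refine max_le (Nat.ceil_lt_add_one (Real.sqrt_nonneg _)).le ?_
  linarith [Real.sqrt_nonneg (lam n * scale K lam n / (K : ℝ))]

theorem one_le_blockLen (n : ℕ) : 1 ≤ blockLen K lam n := le_max_right _ _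

/-- From |B_n| ≥ √(λ_n a_n / K), keeping only the costs in a_n, so that a_n ≥ n^{α+1} / (α+1). -/
theorem rpow_le_mul_blockLen (hα : 0 < α) (hlam : ∀ n : ℕ, 1 ≤ n → lam n = (n : ℝ) ^ α)
    (hK : 1 ≤ K) {n : ℕ} (hn : 1 ≤ n) :
    (n : ℝ) ^ (α + 1 / 2) ≤ √((α + 1) * K) * blockLen K lam n := by
  have hn0 : (0 : ℝ) < n := by exact_mod_cast hn
  have hK0 : (0 : ℝ) < K := by exact_mod_cast hK
  refine le_trans ?_ (mul_le_mul_of_nonneg_left (sqrt_le_blockLen n) (Real.sqrt_nonneg _))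
  rw [← Real.sqrt_mul (by positivity)]
  refine Real.le_sqrt_of_sq_le ?_
  have h1 : ((n : ℝ) ^ (α + 1 / 2)) ^ 2 = (n : ℝ) ^ α * (n : ℝ) ^ (α + 1) := by
    rw [← Real.rpow_natCast, ← Real.rpow_mul hn0.le, ← Real.rpow_add hn0]
    congr 1
    push_cast
    ring
  have h2 : (α + 1) * K * (lam n * scale K lam n / K) = (n : ℝ) ^ α * ((α + 1) * scale K lam n) := by
    rw [hlam n hn]
    field_simp
  rw [h1, h2]
  gcongr
  exact rpow_succ_le_scale hα hlam n

/-- Since √K ≤ K, the division by K absorbs both parts of a_n. The bound is uniform in K; it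
controls the last block and the early blocks. -/
theorem blockLen_le (hα : 0 < α) (hlam : ∀ n : ℕ, 1 ≤ n → lam n = (n : ℝ) ^ α)
    (hK : 1 ≤ K) {n : ℕ} (hn : 1 ≤ n) :
    (blockLen K lam n : ℝ) ≤ 3 * (n : ℝ) ^ (α + 1 / 2) := by
  have hn1 : (1 : ℝ) ≤ n := by exact_mod_cast hn
  have hn0 : (0 : ℝ) < n := by linarith
  have hK1 : (1 : ℝ) ≤ K := by exact_mod_cast hK
  have hK0 : (0 : ℝ) < K := by linarith
  have hpow : ((n : ℝ) ^ (α + 1 / 2)) ^ 2 = (n : ℝ) ^ (2 * α + 1) := by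
    rw [← Real.rpow_natCast, ← Real.rpow_mul hn0.le]
    congr 1
    push_cast
    ring
  have h1 : lam n * scale K lam n / K ≤ 2 * (n : ℝ) ^ (2 * α + 1) := by
    rw [div_le_iff₀ hK0, hlam n hn]
    have e1 : (n : ℝ) ^ α * (n : ℝ) ^ (α + 1) = (n : ℝ) ^ (2 * α + 1) := by
      rw [← Real.rpow_add hn0]; congr 1; ring
    have e2 : (n : ℝ) ^ α * n ≤ (n : ℝ) ^ (2 * α + 1) := by
      rw [← Real.rpow_add_one hn0.ne']
      exact Real.rpow_le_rpow_of_exponent_le hn1 (by linarith)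
    have e3 : √(K : ℝ) ≤ K := by
      rw [Real.sqrt_le_left (by linarith)]
      nlinarith
    have e0 : 0 ≤ (n : ℝ) ^ (2 * α + 1) := by positivity
    calc (n : ℝ) ^ α * scale K lam n
        ≤ (n : ℝ) ^ α * ((n : ℝ) ^ (α + 1) + n * √(K : ℝ)) := by
          gcongr
          exact scale_le hα hlam hn
      _ = (n : ℝ) ^ (2 * α + 1) * 1 + ((n : ℝ) ^ α * n) * √(K : ℝ) := by rw [← e1]; ring
      _ ≤ (n : ℝ) ^ (2 * α + 1) * K + (n : ℝ) ^ (2 * α + 1) * K := by gcongr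
      _ = _ := by ring
  have h2 : √(lam n * scale K lam n / (K : ℝ)) ≤ 2 * (n : ℝ) ^ (α + 1 / 2) := by
    refine Real.sqrt_le_iff.2 ⟨by positivity, h1.trans ?_⟩
    rw [mul_pow, hpow]
    gcongr
    norm_num
  have h3 : 1 ≤ (n : ℝ) ^ (α + 1 / 2) := Real.one_le_rpow hn1 (by linarith)
  linarith [blockLen_le_sqrt_add_one (K := K) (lam := lam) n]

theorem learningRate_inv (n : ℕ) :
    (learningRate K lam n)⁻¹ = 3 / (2 * √(2 * (K : ℝ))) * scale K lam n := by
  rw [learningRate, inv_div]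
  ring

theorem learningRate_pos (hα : 0 < α) (hlam : ∀ n : ℕ, 1 ≤ n → lam n = (n : ℝ) ^ α)
    (hK : 1 ≤ K) {n : ℕ} (hn : 1 ≤ n) : 0 < learningRate K lam n := by
  have h1 := scale_pos (K := K) hα hlam hn
  have h2 : 0 < √(2 * (K : ℝ)) := Real.sqrt_pos.2 (by positivity)
  unfold learningRate
  positivity

theorem learningRate_inv_mono (hα : 0 < α) (hlam : ∀ n : ℕ, 1 ≤ n → lam n = (n : ℝ) ^ α) :
    Monotone fun n => (learningRate K lam n)⁻¹ := by
  refine monotone_nat_of_le_succ fun n => ?_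
  rw [learningRate_inv, learningRate_inv, scale_succ]
  have := one_le_lam hα hlam (n := n + 1) (by omega)
  gcongr
  linarith [Real.sqrt_nonneg ((K : ℝ) / ((n + 1 : ℕ) : ℝ))]

theorem one_div_sqrt_le_lam (hα : 0 < α) (hlam : ∀ n : ℕ, 1 ≤ n → lam n = (n : ℝ) ^ α) {n : ℕ}
    (hn : 1 ≤ n) : 1 / √(n : ℝ) ≤ lam n := by
  have h1 : 1 ≤ √(n : ℝ) := Real.one_le_sqrt.2 (by exact_mod_cast hn)
  exact ((div_le_one (by linarith)).2 h1).trans (one_le_lam hα hlam hn)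

/-- The increment of a_n is λ_n + √(K/n), and both summands are at most √K λ_n. The factor 1/√K in
1/η_n cancels the root. -/
theorem learningRate_inv_sub_le (hα : 0 < α) (hlam : ∀ n : ℕ, 1 ≤ n → lam n = (n : ℝ) ^ α)
    (hK : 1 ≤ K) {n : ℕ} (hn : 1 ≤ n) :
    (learningRate K lam n)⁻¹ - (learningRate K lam (n - 1))⁻¹ ≤ 3 * lam n := by
  obtain ⟨m, rfl⟩ : ∃ m, n = m + 1 := ⟨n - 1, by omega⟩
  have hK1 : (1 : ℝ) ≤ K := by exact_mod_cast hK
  have hl := one_le_lam hα hlam hn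
  have hk : 1 ≤ √(K : ℝ) := Real.one_le_sqrt.2 hK1
  have h2 : 1 ≤ √(2 : ℝ) := Real.one_le_sqrt.2 (by norm_num)
  rw [Nat.add_sub_cancel, learningRate_inv, learningRate_inv, scale_succ, ← mul_sub,
    add_sub_cancel_left, Real.sqrt_mul (by norm_num), Real.sqrt_div (by linarith)]
  have h3 := one_div_sqrt_le_lam hα hlam hn
  have h4 : √(K : ℝ) / √((m + 1 : ℕ) : ℝ) ≤ √(K : ℝ) * lam (m + 1) := by
    rw [div_eq_mul_one_div]
    gcongr
  have h5 : lam (m + 1) ≤ √(K : ℝ) * lam (m + 1) := by nlinarith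
  calc 3 / (2 * (√2 * √(K : ℝ))) * (lam (m + 1) + √(K : ℝ) / √((m + 1 : ℕ) : ℝ))
      ≤ 3 / (2 * (1 * √(K : ℝ))) * (√(K : ℝ) * lam (m + 1) + √(K : ℝ) * lam (m + 1)) := by
        gcongr
    _ = 3 * lam (m + 1) := by
        field_simp
        ring

/-- `η_n ≤ √K / a_n`. -/
theorem learningRate_le (hα : 0 < α) (hlam : ∀ n : ℕ, 1 ≤ n → lam n = (n : ℝ) ^ α) {n : ℕ}
    (hn : 1 ≤ n) : learningRate K lam n ≤ √(K : ℝ) / scale K lam n := by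
  have ha := scale_pos (K := K) hα hlam hn
  have h2 : √(2 : ℝ) ≤ 3 / 2 := by
    rw [Real.sqrt_le_left (by norm_num)]; norm_num
  rw [learningRate, Real.sqrt_mul (by norm_num), div_le_div_iff₀ (by positivity) ha]
  calc 2 * (√2 * √(K : ℝ)) * scale K lam n ≤ 2 * (3 / 2 * √(K : ℝ)) * scale K lam n := by gcongr
    _ = _ := by ring

theorem sqrt_div_scale_le (hα : 0 < α) (hlam : ∀ n : ℕ, 1 ≤ n → lam n = (n : ℝ) ^ α)
    {n : ℕ} (hn : 1 ≤ n) : √(K : ℝ) / scale K lam n ≤ 1 / √(n : ℝ) := by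
  have ha := scale_pos (K := K) hα hlam hn
  have hn0 : 0 < √(n : ℝ) := Real.sqrt_pos.2 (by exact_mod_cast hn)
  rw [div_le_div_iff₀ ha hn0, one_mul, ← Real.sqrt_mul (Nat.cast_nonneg K)]
  exact sqrt_le_scale hα hlam hn

/-- This is the balance behind the choice of |B_n|: up to rounding, η_n |B_n|² is of order (√K /
a_n)(λ_n a_n / K) ≤ λ_n. Rounding up adds a multiple of √K / a_n ≤ 1/√n ≤ λ_n. -/
theorem learningRate_mul_sq_blockLen_le (hα : 0 < α)
    (hlam : ∀ n : ℕ, 1 ≤ n → lam n = (n : ℝ) ^ α) (hK : 1 ≤ K) {n : ℕ} (hn : 1 ≤ n) :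
    learningRate K lam n * (blockLen K lam n : ℝ) ^ 2 ≤ 4 * lam n := by
  have ha := scale_pos (K := K) hα hlam hn
  have hl := one_le_lam hα hlam hn
  have hK1 : (1 : ℝ) ≤ K := by exact_mod_cast hK
  have hk : 1 ≤ √(K : ℝ) := Real.one_le_sqrt.2 hK1
  have hq : 0 ≤ lam n * scale K lam n / (K : ℝ) := by positivity
  have h1 : (blockLen K lam n : ℝ) ^ 2 ≤ 2 * (lam n * scale K lam n / K) + 2 := by
    have e1 := blockLen_le_sqrt_add_one (K := K) (lam := lam) n
    have e2 := Real.sq_sqrt hq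
    have e3 : (blockLen K lam n : ℝ) ^ 2 ≤ (√(lam n * scale K lam n / (K : ℝ)) + 1) ^ 2 := by
      gcongr
    nlinarith [sq_nonneg (√(lam n * scale K lam n / (K : ℝ)) - 1)]
  have h2 := learningRate_le (K := K) hα hlam hn
  have h3 : √(K : ℝ) / scale K lam n * (lam n * scale K lam n / K) ≤ lam n := by
    have e : √(K : ℝ) / scale K lam n * (lam n * scale K lam n / K) = lam n * (√(K : ℝ) / K) := by
      field_simp
    rw [e]
    refine mul_le_of_le_one_right (by linarith) ?_
    rw [div_le_one (by linarith), Real.sqrt_le_left (by linarith)]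
    nlinarith
  have h4 := (sqrt_div_scale_le (K := K) hα hlam hn).trans (one_div_sqrt_le_lam hα hlam hn)
  calc learningRate K lam n * (blockLen K lam n : ℝ) ^ 2
      ≤ √(K : ℝ) / scale K lam n * (2 * (lam n * scale K lam n / K) + 2) := by
        have := (learningRate_pos hα hlam hK hn).le
        gcongr
    _ = 2 * (√(K : ℝ) / scale K lam n * (lam n * scale K lam n / K))
        + 2 * (√(K : ℝ) / scale K lam n) := by ring
    _ ≤ 4 * lam n := by linarith

/-- The main part is √(λ_n / a_n), and a_n ≥ n λ_n / (α+1). The estimate does not depend on K, which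
keeps the burn-in threshold free of K. -/
theorem learningRate_mul_blockLen_le (hα : 0 < α)
    (hlam : ∀ n : ℕ, 1 ≤ n → lam n = (n : ℝ) ^ α) (hK : 1 ≤ K) {n : ℕ} (hn : 1 ≤ n) :
    learningRate K lam n * (blockLen K lam n : ℝ) ≤ (√(α + 1) + 1) / √(n : ℝ) := by
  have ha := scale_pos (K := K) hα hlam hn
  have hl := one_le_lam hα hlam hn
  have hn0 : (0 : ℝ) < n := by exact_mod_cast hn
  have hK0 : (0 : ℝ) < K := by exact_mod_cast hK
  have h1 : √(K : ℝ) / scale K lam n * √(lam n * scale K lam n / (K : ℝ))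
      ≤ √(α + 1) / √(n : ℝ) := by
    have e1 : √(K : ℝ) / scale K lam n * √(lam n * scale K lam n / (K : ℝ))
        = √(lam n / scale K lam n) := by
      rw [div_mul_eq_mul_div, ← Real.sqrt_mul hK0.le]
      have : (K : ℝ) * (lam n * scale K lam n / K) = scale K lam n ^ 2 * (lam n / scale K lam n) := by
        field_simp
      rw [this, Real.sqrt_mul (by positivity), Real.sqrt_sq ha.le]
      field_simp
    rw [e1, ← Real.sqrt_div (by linarith)]
    apply Real.sqrt_le_sqrt
    rw [div_le_div_iff₀ ha hn0, hlam n hn, ← Real.rpow_add_one hn0.ne']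
    exact rpow_succ_le_scale hα hlam n
  calc learningRate K lam n * (blockLen K lam n : ℝ)
      ≤ √(K : ℝ) / scale K lam n * (√(lam n * scale K lam n / (K : ℝ)) + 1) := by
        refine mul_le_mul (learningRate_le hα hlam hn) (blockLen_le_sqrt_add_one n)
          (by positivity) (by positivity)
    _ = √(K : ℝ) / scale K lam n * √(lam n * scale K lam n / (K : ℝ))
        + √(K : ℝ) / scale K lam n := by ring
    _ ≤ √(α + 1) / √(n : ℝ) + 1 / √(n : ℝ) :=
        add_le_add h1 (sqrt_div_scale_le hα hlam hn)
    _ = _ := by ring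

/-- From a block on that depends on `α` only, `η_n |B_n| ≤ 1/4`. -/
theorem exists_learningRate_mul_blockLen_le (hα : 0 < α)
    (hlam : ∀ n : ℕ, 1 ≤ n → lam n = (n : ℝ) ^ α) :
    ∃ n₀ : ℕ, 1 ≤ n₀ ∧ ∀ K : ℕ, 1 ≤ K → ∀ n, n₀ ≤ n →
      learningRate K lam n * (blockLen K lam n : ℝ) ≤ 1 / 4 := by
  refine ⟨⌈(4 * (√(α + 1) + 1)) ^ 2⌉₊ + 1, by omega, fun K hK n hn => ?_⟩
  refine (learningRate_mul_blockLen_le hα hlam hK (by omega)).trans ?_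
  have hn0 : (0 : ℝ) < n := by exact_mod_cast (by omega : 0 < n)
  have h1 : (4 * (√(α + 1) + 1)) ^ 2 ≤ n :=
    (Nat.le_ceil _).trans (by exact_mod_cast (by omega : ⌈(4 * (√(α + 1) + 1)) ^ 2⌉₊ ≤ n))
  have h2 : 4 * (√(α + 1) + 1) ≤ √(n : ℝ) := Real.le_sqrt_of_sq_le h1
  rw [div_le_div_iff₀ (Real.sqrt_pos.2 hn0) (by norm_num)]
  linarith

/-- The number of blocks in terms of the horizon. -/
theorem rpow_number_of_blocks_le (hα : 0 < α) (hlam : ∀ n : ℕ, 1 ≤ n → lam n = (n : ℝ) ^ α)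
    (hK : 1 ≤ K) {T M : ℕ} (hMT : blockEnd (blockLen K lam) M < T) :
    ((M + 1 : ℕ) : ℝ) ^ (α + 3 / 2)
      ≤ 2 ^ (α + 3 / 2) * ((α + 3 / 2) * √(α + 1)) * (√(K : ℝ) * T) := by
  have hT1 : (1 : ℝ) ≤ T := by exact_mod_cast (by omega : 1 ≤ T)
  have hk : 1 ≤ √(K : ℝ) := Real.one_le_sqrt.2 (by exact_mod_cast hK)
  have ha1 : 1 ≤ √(α + 1) := Real.one_le_sqrt.2 (by linarith)
  have hkT : 1 ≤ √(K : ℝ) * T := one_le_mul_of_one_le_of_one_le hk hT1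
  -- The case M = 0 is separate because the other one uses M + 1 ≤ 2M.
  rcases Nat.eq_zero_or_pos M with rfl | hM
  · have h2 : (1 : ℝ) ≤ 2 ^ (α + 3 / 2) := Real.one_le_rpow (by norm_num) (by linarith)
    have h3 : 1 ≤ (α + 3 / 2) * √(α + 1) := one_le_mul_of_one_le_of_one_le (by linarith) ha1
    simp only [zero_add, Nat.cast_one, Real.one_rpow]
    exact one_le_mul_of_one_le_of_one_le (one_le_mul_of_one_le_of_one_le h2 h3) hkT
  · have hM1 : (1 : ℝ) ≤ M := by exact_mod_cast hM
    have h1 := rpow_le_mul_sum_rpow (γ := α + 3 / 2) (by linarith) M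
    -- The M blocks before the last one have total length less than T, and each is bounded below by
    -- a power of its index.
    have h2 : ∑ s ∈ Finset.Icc 1 M, (s : ℝ) ^ (α + 3 / 2 - 1) ≤ √((α + 1) * K) * T := by
      calc ∑ s ∈ Finset.Icc 1 M, (s : ℝ) ^ (α + 3 / 2 - 1)
          ≤ ∑ s ∈ Finset.Icc 1 M, √((α + 1) * K) * blockLen K lam s := by
            refine Finset.sum_le_sum fun s hs => ?_
            have := rpow_le_mul_blockLen hα hlam hK (Finset.mem_Icc.1 hs).1
            rwa [show α + 3 / 2 - 1 = α + 1 / 2 by ring]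
        _ = √((α + 1) * K) * (blockEnd (blockLen K lam) M : ℕ) := by
            rw [← Finset.mul_sum, blockEnd]; push_cast; rfl
        _ ≤ √((α + 1) * K) * T := by gcongr
    calc ((M + 1 : ℕ) : ℝ) ^ (α + 3 / 2) ≤ (2 * (M : ℝ)) ^ (α + 3 / 2) := by
          refine Real.rpow_le_rpow (by positivity) ?_ (by linarith)
          push_cast
          linarith
      _ = 2 ^ (α + 3 / 2) * (M : ℝ) ^ (α + 3 / 2) := Real.mul_rpow (by norm_num) (by linarith)
      _ ≤ 2 ^ (α + 3 / 2) * ((α + 3 / 2) * (√((α + 1) * K) * T)) := by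
          gcongr
          exact h1.trans (by gcongr)
      _ = _ := by rw [Real.sqrt_mul (by linarith)]; ring

theorem exists_powers_of_number_of_blocks_le (hα : 0 < α)
    (hlam : ∀ n : ℕ, 1 ≤ n → lam n = (n : ℝ) ^ α) :
    ∃ c : ℝ, 0 < c ∧ ∀ K : ℕ, 1 ≤ K → ∀ T M : ℕ, blockEnd (blockLen K lam) M < T →
      √(K : ℝ) * ((M + 1 : ℕ) : ℝ) ^ (α + 1 / 2)
        ≤ c * ((K : ℝ) ^ ((2 * α + 2) / (2 * α + 3)) * (T : ℝ) ^ ((2 * α + 1) / (2 * α + 3))) ∧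
      ((M + 1 : ℕ) : ℝ) ^ (2 * α)
        ≤ c * ((K : ℝ) ^ (2 * α / (2 * α + 3)) * (T : ℝ) ^ (4 * α / (2 * α + 3))) := by
  set c₁ : ℝ := 2 ^ (α + 3 / 2) * ((α + 3 / 2) * √(α + 1)) with hc₁
  have ha1 : 0 < √(α + 1) := Real.sqrt_pos.2 (by linarith)
  have hc₁0 : 0 < c₁ := by positivity
  have hd : 0 < 2 * α + 3 := by linarith
  refine ⟨c₁ ^ ((2 * α + 1) / (2 * α + 3)) + c₁ ^ (4 * α / (2 * α + 3)), by positivity,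
    fun K hK T M hMT => ?_⟩
  have hK0 : (0 : ℝ) < K := by exact_mod_cast hK
  have hT0 : (0 : ℝ) < T := by exact_mod_cast (by omega : 0 < T)
  have hN0 : (0 : ℝ) < (M + 1 : ℕ) := by positivity
  have hN := rpow_number_of_blocks_le hα hlam hK hMT
  rw [← hc₁] at hN
  -- Raise N^{α+3/2} ≤ c₁ √K T to the power β, where β = (2α+1)/(2α+3) turns N into N^{α+1/2} and β
  -- = 4α/(2α+3) turns it into N^{2α}.
  have key : ∀ β : ℝ, 0 ≤ β → ((M + 1 : ℕ) : ℝ) ^ ((α + 3 / 2) * β)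
      ≤ c₁ ^ β * ((K : ℝ) ^ (β / 2) * (T : ℝ) ^ β) := by
    intro β hβ
    rw [Real.rpow_mul hN0.le]
    refine (Real.rpow_le_rpow (by positivity) hN hβ).trans (le_of_eq ?_)
    rw [Real.mul_rpow hc₁0.le (by positivity), Real.mul_rpow (by positivity) hT0.le,
      Real.sqrt_eq_rpow, ← Real.rpow_mul hK0.le]
    congr 3
    ring
  constructor
  · have h := key ((2 * α + 1) / (2 * α + 3)) (by positivity)
    rw [show (α + 3 / 2) * ((2 * α + 1) / (2 * α + 3)) = α + 1 / 2 by field_simp] at h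
    have hKe : √(K : ℝ) * (K : ℝ) ^ ((2 * α + 1) / (2 * α + 3) / 2)
        = (K : ℝ) ^ ((2 * α + 2) / (2 * α + 3)) := by
      rw [Real.sqrt_eq_rpow, ← Real.rpow_add hK0]
      congr 1
      field_simp
      ring
    calc √(K : ℝ) * ((M + 1 : ℕ) : ℝ) ^ (α + 1 / 2)
        ≤ √(K : ℝ) * (c₁ ^ ((2 * α + 1) / (2 * α + 3))
          * ((K : ℝ) ^ ((2 * α + 1) / (2 * α + 3) / 2) * (T : ℝ) ^ ((2 * α + 1) / (2 * α + 3)))) := by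
          gcongr
      _ = c₁ ^ ((2 * α + 1) / (2 * α + 3)) * ((K : ℝ) ^ ((2 * α + 2) / (2 * α + 3))
          * (T : ℝ) ^ ((2 * α + 1) / (2 * α + 3))) := by rw [← hKe]; ring
      _ ≤ _ := by
          gcongr
          exact le_add_of_nonneg_right (by positivity)
  · have h := key (4 * α / (2 * α + 3)) (by positivity)
    rw [show (α + 3 / 2) * (4 * α / (2 * α + 3)) = 2 * α by field_simp; ring,
      show 4 * α / (2 * α + 3) / 2 = 2 * α / (2 * α + 3) by ring] at h
    refine h.trans ?_
    gcongr
    exact le_add_of_nonneg_left (by positivity)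

/-- The summand is of order √K n^{α-1/2}, whose exponent may have either sign. Bounding n^α by its
largest value and summing only 1/√n avoids the case distinction. -/
theorem sum_rpow_div_blockLen_le (hα : 0 < α) (hlam : ∀ n : ℕ, 1 ≤ n → lam n = (n : ℝ) ^ α)
    (hK : 1 ≤ K) (M : ℕ) :
    ∑ n ∈ Finset.Icc 1 M, lam n ^ 2 / (blockLen K lam n : ℝ)
      ≤ 2 * √(α + 1) * (√(K : ℝ) * ((M + 1 : ℕ) : ℝ) ^ (α + 1 / 2)) := by
  have hM0 : (0 : ℝ) < (M + 1 : ℕ) := by positivity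
  have hMM : (M : ℝ) ≤ (M + 1 : ℕ) := by push_cast; linarith
  have hterm : ∀ n ∈ Finset.Icc 1 M, lam n ^ 2 / (blockLen K lam n : ℝ)
      ≤ √((α + 1) * K) * ((M + 1 : ℕ) : ℝ) ^ α * (1 / √(n : ℝ)) := by
    intro n hn
    obtain ⟨hn1, hnM⟩ := Finset.mem_Icc.1 hn
    have hn0 : (0 : ℝ) < n := by exact_mod_cast hn1
    have hB : (0 : ℝ) < blockLen K lam n := by exact_mod_cast one_le_blockLen n
    have hs : 0 < √(n : ℝ) := Real.sqrt_pos.2 hn0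
    have h1 := rpow_le_mul_blockLen hα hlam hK hn1
    have h2 : (n : ℝ) ^ (α + 1 / 2) = (n : ℝ) ^ α * √(n : ℝ) := by
      rw [Real.rpow_add hn0, Real.sqrt_eq_rpow]
    have h3 : (n : ℝ) ^ α ≤ ((M + 1 : ℕ) : ℝ) ^ α :=
      Real.rpow_le_rpow hn0.le (by exact_mod_cast (by omega : n ≤ M + 1)) hα.le
    rw [h2] at h1
    rw [hlam n hn1, mul_one_div, div_le_div_iff₀ hB hs]
    calc ((n : ℝ) ^ α) ^ 2 * √(n : ℝ) = (n : ℝ) ^ α * ((n : ℝ) ^ α * √(n : ℝ)) := by ring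
      _ ≤ ((M + 1 : ℕ) : ℝ) ^ α * (√((α + 1) * K) * blockLen K lam n) := by gcongr
      _ = _ := by ring
  refine (Finset.sum_le_sum hterm).trans ?_
  rw [← Finset.mul_sum, Real.sqrt_mul (by linarith), Real.rpow_add hM0, ← Real.sqrt_eq_rpow]
  calc √(α + 1) * √(K : ℝ) * ((M + 1 : ℕ) : ℝ) ^ α * ∑ n ∈ Finset.Icc 1 M, 1 / √(n : ℝ)
      ≤ √(α + 1) * √(K : ℝ) * ((M + 1 : ℕ) : ℝ) ^ α * (2 * √((M + 1 : ℕ) : ℝ)) := by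
        gcongr
        exact (sum_one_div_sqrt_le M).trans (by gcongr)
    _ = _ := by ring

end PowerCosts

/-! ### The final bound and its growth -/

theorem powerBound_eq {K : ℕ} (α : ℝ) (Δ : Fin K → ℝ) (best : Fin K) (T : ℕ) :
    powerBound α Δ best T = (∑ i ∈ Finset.univ.erase best, 1 / Δ i)
      * ((K : ℝ) ^ ((2 * α + 2) / (2 * α + 3)) * (T : ℝ) ^ ((2 * α + 1) / (2 * α + 3))
        + (K : ℝ) ^ (2 * α / (2 * α + 3)) * (T : ℝ) ^ (4 * α / (2 * α + 3))) := by
  rw [powerBound, Finset.sum_mul]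
  exact Finset.sum_congr rfl fun i _ => by ring

theorem isLittleO_natCast_rpow {e : ℝ} (he : e < 1) :
    (fun T : ℕ => (T : ℝ) ^ e) =o[atTop] (fun T : ℕ => (T : ℝ)) := by
  refine isLittleO_of_tendsto' ?_ ?_
  · filter_upwards [eventually_ge_atTop 1] with T hT h
    have : (0 : ℝ) < T := by exact_mod_cast hT
    exact absurd h this.ne'
  · refine ((tendsto_rpow_neg_atTop (sub_pos.2 he)).comp tendsto_natCast_atTop_atTop).congr' ?_
    filter_upwards [eventually_ge_atTop 1] with T hT
    have : (0 : ℝ) < T := by exact_mod_cast hT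
    rw [Function.comp_apply, neg_sub, Real.rpow_sub_one this.ne']

/-- The exponent (2α+1)/(2α+3) is always below one; 4α/(2α+3) is so exactly when α < 3/2. -/
theorem powerBound_isLittleO {α : ℝ} (hα : 0 < α) (hα' : α < 3 / 2) {K : ℕ} (Δ : Fin K → ℝ)
    (best : Fin K) :
    (fun T : ℕ => powerBound α Δ best T) =o[atTop] (fun T : ℕ => (T : ℝ)) := by
  have hd : 0 < 2 * α + 3 := by linarith
  simp only [powerBound_eq]
  refine IsLittleO.const_mul_left (IsLittleO.add ?_ ?_) _
  · refine (isLittleO_natCast_rpow ?_).const_mul_left _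
    rw [div_lt_one hd]; linarith
  · refine (isLittleO_natCast_rpow ?_).const_mul_left _
    rw [div_lt_one hd]; linarith

/-- Losses in [0,1] force gaps of at most 1, so ∑ 1/Δ_i can absorb a factor K as well as constants.
-/
theorem card_sub_one_le_sum_one_div {K : ℕ} {Δ : Fin K → ℝ} {best : Fin K}
    (hpos : ∀ i, i ≠ best → 0 < Δ i) (hle : ∀ i, i ≠ best → Δ i ≤ 1) :
    (K : ℝ) - 1 ≤ ∑ i ∈ Finset.univ.erase best, 1 / Δ i := by
  have h := Finset.card_nsmul_le_sum (Finset.univ.erase best) (fun i => 1 / Δ i) 1 fun i hi => by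
    have hi := Finset.ne_of_mem_erase hi
    rw [le_div_iff₀ (hpos i hi), one_mul]
    exact hle i hi
  rw [nsmul_eq_mul, mul_one, Finset.card_erase_of_mem (Finset.mem_univ _), Finset.card_univ,
    Fintype.card_fin, Nat.cast_sub best.pos, Nat.cast_one] at h
  exact h

/-! ### Collecting the contributions -/

section

variable {α : ℝ} {lam : ℕ → ℝ}

theorem burnIn_le {K n₀ : ℕ} (hn₀ : 1 ≤ n₀)
    (h : ∀ n, n₀ ≤ n → learningRate K lam n * (blockLen K lam n : ℝ) ≤ 1 / 4) (N : ℕ) :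
    burnIn K lam N ≤ n₀ := by
  unfold burnIn
  simp only
  split_ifs with hne
  · by_cases hN : n₀ ≤ N
    · exact Nat.sInf_le ⟨hn₀, hN, h⟩
    · have := (Nat.sInf_mem hne).2.1
      omega
  · by_contra hcon
    exact hne ⟨n₀, hn₀, by omega, h⟩

/-- `√K N^{α + 1/2} ∑_{i ≠ i*} 1/Δ_i`, the common bound of all but one of the contributions. -/
noncomputable def blockBound {K : ℕ} (α : ℝ) (Δ : Fin K → ℝ) (best : Fin K) (N : ℕ) : ℝ :=
  (∑ i ∈ Finset.univ.erase best, 1 / Δ i) * (√(K : ℝ) * (N : ℝ) ^ (α + 1 / 2))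

theorem one_le_sum_one_div {K : ℕ} (hK : 2 ≤ K) {Δ : Fin K → ℝ} {best : Fin K}
    (hpos : ∀ i, i ≠ best → 0 < Δ i) (hle : ∀ i, i ≠ best → Δ i ≤ 1) :
    1 ≤ ∑ i ∈ Finset.univ.erase best, 1 / Δ i := by
  have hK' : (2 : ℝ) ≤ K := by exact_mod_cast hK
  linarith [card_sub_one_le_sum_one_div hpos hle]

/-- The three leftovers to be absorbed: constants, the length of the last block, and λ_N times the
crude bound K for the roots in the last block. The last one uses K ≤ 2(K - 1) ≤ 2 ∑ 1/Δ_i. -/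
theorem rpow_le_blockBound (hα : 0 < α) {K : ℕ} (hK : 2 ≤ K) {Δ : Fin K → ℝ} {best : Fin K}
    (hpos : ∀ i, i ≠ best → 0 < Δ i) (hle : ∀ i, i ≠ best → Δ i ≤ 1) {N : ℕ} (hN : 1 ≤ N) :
    1 ≤ blockBound α Δ best N ∧ (N : ℝ) ^ (α + 1 / 2) ≤ blockBound α Δ best N ∧
      (N : ℝ) ^ α * K ≤ 2 * blockBound α Δ best N := by
  have hN1 : (1 : ℝ) ≤ N := by exact_mod_cast hN
  have hK' : (2 : ℝ) ≤ K := by exact_mod_cast hK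
  have hS := one_le_sum_one_div hK hpos hle
  have hS' := card_sub_one_le_sum_one_div hpos hle
  have hk : 1 ≤ √(K : ℝ) := Real.one_le_sqrt.2 (by linarith)
  have hp : 1 ≤ (N : ℝ) ^ (α + 1 / 2) := Real.one_le_rpow hN1 (by linarith)
  unfold blockBound
  set S := ∑ i ∈ Finset.univ.erase best, 1 / Δ i
  have h2 : (N : ℝ) ^ (α + 1 / 2) ≤ S * (√(K : ℝ) * (N : ℝ) ^ (α + 1 / 2)) := by
    calc (N : ℝ) ^ (α + 1 / 2) = 1 * (1 * (N : ℝ) ^ (α + 1 / 2)) := by ring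
      _ ≤ _ := by gcongr
  refine ⟨hp.trans h2, h2, ?_⟩
  calc (N : ℝ) ^ α * K ≤ (N : ℝ) ^ (α + 1 / 2) * (2 * S) := by
        refine mul_le_mul (Real.rpow_le_rpow_of_exponent_le hN1 (by linarith)) (by linarith)
          (by linarith) (by linarith)
    _ = 2 * (S * (1 * (N : ℝ) ^ (α + 1 / 2))) := by ring
    _ ≤ _ := by gcongr

theorem sum_sq_div_le (hα : 0 < α) (hlam : ∀ n : ℕ, 1 ≤ n → lam n = (n : ℝ) ^ α) {K : ℕ}
    (hK : 2 ≤ K) {Δ : Fin K → ℝ} {best : Fin K} (hpos : ∀ i, i ≠ best → 0 < Δ i)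
    (D : ℝ) (M : ℕ) :
    ∑ n ∈ Finset.Icc 1 M, ∑ i ∈ Finset.univ.erase best,
      (D * lam n) ^ 2 / (4 * Δ i * (blockLen K lam n : ℝ))
      ≤ D ^ 2 * √(α + 1) * blockBound α Δ best (M + 1) := by
  have hS : 0 ≤ ∑ i ∈ Finset.univ.erase best, 1 / Δ i :=
    Finset.sum_nonneg fun i hi => (one_div_pos.2 (hpos i (Finset.ne_of_mem_erase hi))).le
  have h := sum_rpow_div_blockLen_le hα hlam (by omega : 1 ≤ K) M
  calc ∑ n ∈ Finset.Icc 1 M, ∑ i ∈ Finset.univ.erase best,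
        (D * lam n) ^ 2 / (4 * Δ i * (blockLen K lam n : ℝ))
      = D ^ 2 / 4 * (∑ i ∈ Finset.univ.erase best, 1 / Δ i)
        * ∑ n ∈ Finset.Icc 1 M, lam n ^ 2 / (blockLen K lam n : ℝ) := by
        rw [Finset.mul_sum]
        refine Finset.sum_congr rfl fun n _ => ?_
        rw [Finset.mul_sum, Finset.sum_mul]
        refine Finset.sum_congr rfl fun i _ => ?_
        rw [div_mul_div_comm, div_mul_div_comm]
        congr 1
        ring
    _ ≤ D ^ 2 / 4 * (∑ i ∈ Finset.univ.erase best, 1 / Δ i)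
        * (2 * √(α + 1) * (√(K : ℝ) * ((M + 1 : ℕ) : ℝ) ^ (α + 1 / 2))) := by gcongr
    _ = 1 / 2 * (D ^ 2 * √(α + 1) * blockBound α Δ best (M + 1)) := by
        rw [blockBound]; ring
    _ ≤ _ := by
        have : 0 ≤ D ^ 2 * √(α + 1) * blockBound α Δ best (M + 1) := by
          unfold blockBound; positivity
        linarith

/-- The complete blocks and the burn-in fit into `blockBound`. The truncated last block is only
known to contain one round, which produces the extra N^{2α}. -/
theorem generalBound_le (hα : 0 < α) (hlam : ∀ n : ℕ, 1 ≤ n → lam n = (n : ℝ) ^ α) :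
    ∃ C : ℝ, 0 < C ∧ ∀ K : ℕ, 2 ≤ K → ∀ (Δ : Fin K → ℝ) (best : Fin K),
      (∀ i, i ≠ best → 0 < Δ i) → (∀ i, i ≠ best → Δ i ≤ 1) →
      ∀ T M : ℕ, blockOf (blockLen K lam) T = M + 1 → blockEnd (blockLen K lam) M < T →
        T ≤ blockEnd (blockLen K lam) (M + 1) →
        generalBound lam Δ best T ≤ C * (blockBound α Δ best (M + 1)
          + (∑ i ∈ Finset.univ.erase best, 1 / Δ i) * ((M + 1 : ℕ) : ℝ) ^ (2 * α)) := by
  obtain ⟨n₀, hn₀, hburn⟩ := exists_learningRate_mul_blockLen_le hα hlam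
  -- 11 from λ_n, 2^α from λ_{n+1} ≤ 2^α λ_n, and 15 from 10√2/√n ≤ 15 λ_n. In `c` below, the final
  -- 3 is λ_1 + 2.
  set E : ℝ := 26 + 2 ^ α with hE
  have hE0 : 0 < E := by positivity
  set c : ℝ := n₀ * (3 * (n₀ : ℝ) ^ α) + 4 * √(2 * (n₀ : ℝ)) + 3 with hc
  have hc0 : 0 < c := by positivity
  refine ⟨E ^ 2 * √(α + 1) + E ^ 2 + c, by positivity, ?_⟩
  intro K hK Δ best hpos hle T M hM hMT hTM
  obtain ⟨hW1, -, -⟩ := rpow_le_blockBound hα hK hpos hle (N := M + 1) (by omega)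
  have hS := one_le_sum_one_div hK hpos hle
  have hcoef : ∀ n, 1 ≤ n → (11 * lam n + lam (n + 1) + 10 * √2 / √(n : ℝ)) ^ 2
      ≤ (E * lam n) ^ 2 := by
    intro n hn
    have h1 := one_le_lam hα hlam hn
    have h2 := lam_succ_le hα hlam hn
    have h3 := one_div_sqrt_le_lam hα hlam hn
    have h4 : √(2 : ℝ) ≤ 3 / 2 := by
      rw [Real.sqrt_le_left (by norm_num)]; norm_num
    have h5 : 10 * √2 / √(n : ℝ) ≤ 15 * lam n := by
      rw [div_eq_mul_one_div]
      exact mul_le_mul (by linarith) h3 (by positivity) (by norm_num)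
    have h6 : 0 ≤ 10 * √2 / √(n : ℝ) := by positivity
    have h7 := one_le_lam hα hlam (n := n + 1) (by omega)
    refine pow_le_pow_left₀ (by linarith) ?_ 2
    rw [hE, add_mul]
    linarith
  have hlen : ∀ n ∈ Finset.Icc 1 M,
      truncatedLen (blockLen K lam) T n = blockLen K lam n := by
    intro n hn
    obtain ⟨hn1, hnM⟩ := Finset.mem_Icc.1 hn
    have h1 := blockEnd_mono (blockLen K lam) hnM
    have h2 := card_block (blockLen K lam) hn1
    rw [Nat.card_Ioc] at h2
    rw [truncatedLen, min_eq_left (by omega), h2]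
  have hlast : 1 ≤ truncatedLen (blockLen K lam) T (M + 1) := by
    rw [truncatedLen, Nat.add_sub_cancel, min_eq_right hTM]
    omega
  have hfirst : ∑ n ∈ Finset.Icc 1 M, ∑ i ∈ Finset.univ.erase best,
      (11 * lam n + lam (n + 1) + 10 * √2 / √(n : ℝ)) ^ 2
        / (4 * Δ i * (truncatedLen (blockLen K lam) T n : ℝ))
      ≤ E ^ 2 * √(α + 1) * blockBound α Δ best (M + 1) := by
    refine le_trans ?_ (sum_sq_div_le hα hlam hK hpos E M)
    refine Finset.sum_le_sum fun n hn => Finset.sum_le_sum fun i hi => ?_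
    have hΔ := hpos i (Finset.ne_of_mem_erase hi)
    rw [hlen n hn]
    gcongr ?_ / _
    exact hcoef n (Finset.mem_Icc.1 hn).1
  have hfinal : ∑ i ∈ Finset.univ.erase best,
      (11 * lam (M + 1) + lam (M + 1 + 1) + 10 * √2 / √((M + 1 : ℕ) : ℝ)) ^ 2
        / (4 * Δ i * (truncatedLen (blockLen K lam) T (M + 1) : ℝ))
      ≤ E ^ 2 * ((∑ i ∈ Finset.univ.erase best, 1 / Δ i)
        * ((M + 1 : ℕ) : ℝ) ^ (2 * α)) := by
    rw [Finset.sum_mul, Finset.mul_sum]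
    refine Finset.sum_le_sum fun i hi => ?_
    have hΔ := hpos i (Finset.ne_of_mem_erase hi)
    have hL : (1 : ℝ) ≤ truncatedLen (blockLen K lam) T (M + 1) := by exact_mod_cast hlast
    have hsq : (E * lam (M + 1)) ^ 2 = E ^ 2 * ((M + 1 : ℕ) : ℝ) ^ (2 * α) := by
      rw [mul_pow, hlam (M + 1) (by omega), ← Real.rpow_natCast (_ ^ α), ← Real.rpow_mul
        (by positivity)]
      congr 2
      push_cast
      ring
    calc _ ≤ (E * lam (M + 1)) ^ 2 / Δ i := by
          refine div_le_div₀ (by positivity) (hcoef (M + 1) (by omega)) hΔ ?_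
          nlinarith
      _ = _ := by rw [hsq]; ring
  have hN₀ := burnIn_le hn₀ (hburn K (by omega)) (M + 1)
  set N₀ := burnIn K lam (M + 1) with hN₀def
  have hN₀' : (N₀ : ℝ) ≤ n₀ := by exact_mod_cast hN₀
  have hswitch : ∑ n ∈ Finset.Icc 1 N₀, 2 * √2 * lam n / √(K : ℝ) ≤ n₀ * (3 * (n₀ : ℝ) ^ α) := by
    have hk : 1 ≤ √(K : ℝ) := Real.one_le_sqrt.2 (by exact_mod_cast (by omega : 1 ≤ K))
    have h4 : √(2 : ℝ) ≤ 3 / 2 := by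
      rw [Real.sqrt_le_left (by norm_num)]; norm_num
    refine (Finset.sum_le_card_nsmul _ _ (3 * (n₀ : ℝ) ^ α) fun n hn => ?_).trans ?_
    · obtain ⟨hn1, hnN⟩ := Finset.mem_Icc.1 hn
      have h1 : lam n ≤ (n₀ : ℝ) ^ α := by
        rw [hlam n hn1]
        exact Real.rpow_le_rpow (by positivity) (by exact_mod_cast hnN.trans hN₀) hα.le
      have h2 := one_le_lam hα hlam hn1
      refine (div_le_self (by positivity) hk).trans ?_
      refine mul_le_mul (by linarith) h1 (by linarith) (by norm_num)
    · rw [nsmul_eq_mul, Nat.card_Icc, Nat.add_sub_cancel]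
      gcongr
  have hroot : 4 * √(2 * (N₀ : ℝ)) ≤ 4 * √(2 * (n₀ : ℝ)) := by gcongr
  have hlam1 : lam 1 = 1 := by rw [hlam 1 le_rfl]; simp
  have hgb : generalBound lam Δ best T
      ≤ E ^ 2 * √(α + 1) * blockBound α Δ best (M + 1)
        + E ^ 2 * ((∑ i ∈ Finset.univ.erase best, 1 / Δ i) * ((M + 1 : ℕ) : ℝ) ^ (2 * α))
        + c := by
    unfold generalBound
    simp only [hM]
    rw [Finset.sum_Icc_succ_top (by omega), ← hN₀def, hlam1, hc]
    linarith
  refine hgb.trans ?_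
  set W := blockBound α Δ best (M + 1)
  set V := (∑ i ∈ Finset.univ.erase best, 1 / Δ i) * ((M + 1 : ℕ) : ℝ) ^ (2 * α)
  have hV : 0 ≤ V := by positivity
  have e1 : 0 ≤ E ^ 2 * √(α + 1) * V := by positivity
  have e2 : 0 ≤ E ^ 2 * W := by positivity
  have e3 : c * 1 ≤ c * W := by gcongr
  have e4 : 0 ≤ c * V := by positivity
  linarith [add_mul (E ^ 2 * √(α + 1) + E ^ 2) c (W + V),
    add_mul (E ^ 2 * √(α + 1)) (E ^ 2) (W + V), mul_add (E ^ 2 * √(α + 1)) W V,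
    mul_add (E ^ 2) W V, mul_add c W V]

/-- With G the regret of the first M blocks and Q = ∑ λ_n x_n, the bound G ≤ 20 Q + … is used twice
and one copy of G is subtracted for self-bounding. No N^{2α} arises, since the last block is charged
its length. -/
theorem switchingRegret_le (hα : 0 < α) (hlam : ∀ n : ℕ, 1 ≤ n → lam n = (n : ℝ) ^ α) :
    ∃ C : ℝ, 0 < C ∧ ∀ (K : ℕ) [NeZero K], 2 ≤ K →
      ∀ (Ω : Type*) [MeasurableSpace Ω] (P : Measure Ω) [IsProbabilityMeasure P]
        (ℓ : ℕ → Ω → Fin K → ℝ) (gap : Fin K → Fin K → ℝ), IsStochConstrained P ℓ gap →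
      ∀ best : Fin K, (∀ i, i ≠ best → 0 < subopt gap i) →
      ∀ (I : ℕ → Ω → Fin K) (p : ℕ → Ω → Fin K → ℝ),
        IsRun P ℓ (blockLen K lam) (learningRate K lam) I p →
      ∀ T M : ℕ, blockOf (blockLen K lam) T = M + 1 → blockEnd (blockLen K lam) M < T →
        T ≤ blockEnd (blockLen K lam) (M + 1) →
        switchingRegret P ℓ (blockLen K lam) lam I T
          ≤ C * blockBound α (subopt gap) best (M + 1) := by
  obtain ⟨n₀, hn₀, hburn⟩ := exists_learningRate_mul_blockLen_le hα hlam
  -- Twice 20 = 8 + 12 from stability and penalty, plus 1 + 2^α from switching. The 54 below is 2·25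
  -- for the last λ x term (12 twice from the penalty, once from switching), 3 for the last block
  -- and 1 for λ_1.
  set D : ℝ := 41 + 2 ^ α with hD
  set c : ℝ := n₀ * (3 * (n₀ : ℝ) ^ (α + 1 / 2)) with hc
  have hc0 : 0 ≤ c := by positivity
  refine ⟨D ^ 2 * √(α + 1) + 2 * c + 54, by positivity, ?_⟩
  intro K _ hK Ω _ P _ ℓ gap henv best hbest I p hrun T M hM hMT hTM
  have hK1 : 1 ≤ K := by omega
  have hle : ∀ i, i ≠ best → subopt gap i ≤ 1 := fun i _ => subopt_le_one henv hbest i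
  obtain ⟨hW1, hW2, hW3⟩ := rpow_le_blockBound hα hK hbest hle (N := M + 1) (by omega)
  have hη : ∀ n, 1 ≤ n → 0 < learningRate K lam n := fun n hn => learningRate_pos hα hlam hK1 hn
  set x : ℕ → ℝ := meanRoot P p best with hx
  have hx0 : ∀ n, 0 ≤ x n := meanRoot_nonneg best
  have hl0 : ∀ n, 1 ≤ n → 0 ≤ lam n := fun n hn => zero_le_one.trans (one_le_lam hα hlam hn)
  set V : ℕ → ℝ := fun n => blockLen K lam n * ∑ i, subopt gap i * meanProb P p n i with hV
  -- a_0 is an empty sum, so (η_0)⁻¹ = 0 as the telescoping requires.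
  have hfree := regret_blocks_le hη (by rw [learningRate_inv, scale_zero, mul_zero])
    (learningRate_inv_mono hα hlam) henv hrun hbest M
  have hstab : ∑ n ∈ Finset.Icc 1 M, (if learningRate K lam n * blockLen K lam n ≤ 1
        then 2 * (learningRate K lam n * blockLen K lam n ^ 2) * x n else (blockLen K lam n : ℝ))
      ≤ ∑ n ∈ Finset.Icc 1 M, 8 * (lam n * x n) + c := by
    -- A block with η_n |B_n| > 1 has n < n₀, so its length is bounded in terms of α alone, and
    -- there are at most n₀ such blocks.
    have hterm : ∀ n ∈ Finset.Icc 1 M, (if learningRate K lam n * blockLen K lam n ≤ 1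
        then 2 * (learningRate K lam n * blockLen K lam n ^ 2) * x n else (blockLen K lam n : ℝ))
        ≤ 8 * (lam n * x n) + if n < n₀ then 3 * (n₀ : ℝ) ^ (α + 1 / 2) else 0 := by
      intro n hn
      have hn1 := (Finset.mem_Icc.1 hn).1
      have hlx := mul_nonneg (hl0 n hn1) (hx0 n)
      split_ifs with h1 h2 h2
      · have h3 := mul_le_mul_of_nonneg_right
          (learningRate_mul_sq_blockLen_le hα hlam hK1 hn1) (hx0 n)
        have h4 : 0 ≤ 3 * (n₀ : ℝ) ^ (α + 1 / 2) := by positivity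
        linarith
      · have h3 := mul_le_mul_of_nonneg_right
          (learningRate_mul_sq_blockLen_le hα hlam hK1 hn1) (hx0 n)
        linarith
      · have h3 : (n : ℝ) ^ (α + 1 / 2) ≤ (n₀ : ℝ) ^ (α + 1 / 2) :=
          Real.rpow_le_rpow (by positivity) (by exact_mod_cast h2.le) (by linarith)
        linarith [blockLen_le hα hlam hK1 hn1]
      · linarith [hburn K hK1 n (by omega)]
    refine (Finset.sum_le_sum hterm).trans ?_
    rw [Finset.sum_add_distrib]
    gcongr
    rw [← Finset.sum_filter, Finset.sum_const, nsmul_eq_mul, hc]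
    gcongr
    calc ((Finset.Icc 1 M).filter (· < n₀)).card ≤ (Finset.range n₀).card :=
          Finset.card_le_card fun n hn => Finset.mem_range.2 (Finset.mem_filter.1 hn).2
      _ = n₀ := Finset.card_range n₀
  have hpen : ∑ n ∈ Finset.Icc 1 (M + 1),
      ((learningRate K lam n)⁻¹ - (learningRate K lam (n - 1))⁻¹) * (4 * x n)
      ≤ ∑ n ∈ Finset.Icc 1 M, 12 * (lam n * x n) + 12 * (lam (M + 1) * x (M + 1)) := by
    rw [← Finset.sum_Icc_succ_top (by omega) fun n => 12 * (lam n * x n)]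
    refine Finset.sum_le_sum fun n hn => ?_
    have := mul_le_mul_of_nonneg_right
      (learningRate_inv_sub_le hα hlam hK1 (Finset.mem_Icc.1 hn).1) (hx0 n)
    linarith
  have hswitch : switchingCost P (blockLen K lam) lam I T
      ≤ 1 + ∑ n ∈ Finset.Icc 1 M, (1 + 2 ^ α) * (lam n * x n) + lam (M + 1) * x (M + 1) := by
    refine (switchingCost_le hη henv hrun best hl0 hM).trans ?_
    have hlam1 : lam 1 = 1 := by rw [hlam 1 le_rfl]; simp
    rw [hlam1]
    refine add_le_add_left (add_le_add_right (Finset.sum_le_sum fun n hn => ?_) _) _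
    have h1 := mul_le_mul_of_nonneg_right (lam_succ_le hα hlam (Finset.mem_Icc.1 hn).1) (hx0 n)
    rw [← hx]
    linarith
  have hpseudo := pseudoRegret_le hη henv hrun hbest hMT hTM
  have hself : ∑ n ∈ Finset.Icc 1 M, (D * (lam n * x n) - V n)
      ≤ D ^ 2 * √(α + 1) * blockBound α (subopt gap) best (M + 1) := by
    refine le_trans (Finset.sum_le_sum fun n hn => ?_) (sum_sq_div_le hα hlam hK hbest D M)
    have hB : (0 : ℝ) < blockLen K lam n := by exact_mod_cast one_le_blockLen n
    rw [← mul_assoc]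
    exact mul_meanRoot_sub_le hη henv hrun hbest (Finset.mem_Icc.1 hn).1 hB (D * lam n)
  have hlastx : lam (M + 1) * x (M + 1) ≤ 2 * blockBound α (subopt gap) best (M + 1) := by
    refine le_trans ?_ hW3
    rw [hlam (M + 1) (by omega)]
    gcongr
    exact meanRoot_le hη henv hrun best (by omega)
  have hlastB := (blockLen_le hα hlam hK1 (n := M + 1) (by omega)).trans
    (mul_le_mul_of_nonneg_left hW2 (by norm_num))
  rw [Finset.sum_sub_distrib, ← Finset.mul_sum, hD] at hself
  rw [← Finset.mul_sum] at hstab hpen hswitch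
  rw [switchingRegret]
  have hcW : c * 1 ≤ c * blockBound α (subopt gap) best (M + 1) := by gcongr
  set W := blockBound α (subopt gap) best (M + 1)
  set Q := ∑ n ∈ Finset.Icc 1 M, lam n * x n
  have hG : ∑ n ∈ Finset.Icc 1 M, V n ≤ 20 * Q + c + 12 * (lam (M + 1) * x (M + 1)) := by
    linarith
  rw [← hD] at hself
  have hDQ : D * Q = 40 * Q + (1 + 2 ^ α) * Q := by rw [hD]; ring
  have hCW : (D ^ 2 * √(α + 1) + 2 * c + 54) * W
      = D ^ 2 * √(α + 1) * W + 2 * (c * W) + 54 * W := by ring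
  linarith

end

theorem corollary2 (α : ℝ) (hα : 0 < α) (lam : ℕ → ℝ)
    (hlam : ∀ n : ℕ, 1 ≤ n → lam n = (n : ℝ) ^ α) :
    -- the constant depends on `α` only; the losses, the gaps, the number of arms and the horizon
    -- are arbitrary
    (∃ C : ℝ, 0 < C ∧
      ∀ (K : ℕ) [NeZero K], 2 ≤ K →
      ∀ (Ω : Type*) [MeasurableSpace Ω] (P : Measure Ω) [IsProbabilityMeasure P]
        (ℓ : ℕ → Ω → Fin K → ℝ) (gap : Fin K → Fin K → ℝ),
        IsStochConstrained P ℓ gap →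
      ∀ best : Fin K, (∀ i, i ≠ best → 0 < subopt gap i) →
      ∀ (I : ℕ → Ω → Fin K) (p : ℕ → Ω → Fin K → ℝ),
        IsRun P ℓ (blockLen K lam) (learningRate K lam) I p →
      ∀ T : ℕ, 1 ≤ T →
        switchingRegret P ℓ (blockLen K lam) lam I T ≤ C * powerBound α (subopt gap) best T ∧
        generalBound lam (subopt gap) best T ≤ C * powerBound α (subopt gap) best T) ∧
    -- the bound is sublinear in the horizon if `α < 3/2`
    (α < 3 / 2 →
      ∀ (K : ℕ) (Δ : Fin K → ℝ) (best : Fin K), (∀ i, i ≠ best → 0 < Δ i) →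
        (fun T : ℕ => powerBound α Δ best T) =o[atTop] (fun T : ℕ => (T : ℝ))) := by

  refine ⟨?_, fun hα' K Δ best _ => powerBound_isLittleO hα hα' Δ best⟩
  obtain ⟨c, hc, hpow⟩ := exists_powers_of_number_of_blocks_le hα hlam
  obtain ⟨C₁, hC₁, hreg⟩ := switchingRegret_le hα hlam
  obtain ⟨C₂, hC₂, hgen⟩ := generalBound_le hα hlam
  refine ⟨(C₁ + C₂) * c, by positivity, ?_⟩
  intro K _ hK Ω _ P _ ℓ gap henv best hbest I p hrun T hT
  obtain ⟨M, hM, hMT, hTM⟩ := blockOf_spec (fun n => one_le_blockLen (K := K) (lam := lam) n) hT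
  have hle : ∀ i, i ≠ best → subopt gap i ≤ 1 := fun i _ => subopt_le_one henv hbest i
  have hS := one_le_sum_one_div hK hbest hle
  obtain ⟨h1, h2⟩ := hpow K (by omega) T M hMT
  have hW : blockBound α (subopt gap) best (M + 1)
      + (∑ i ∈ Finset.univ.erase best, 1 / subopt gap i) * ((M + 1 : ℕ) : ℝ) ^ (2 * α)
      ≤ c * powerBound α (subopt gap) best T := by
    rw [blockBound, powerBound_eq, ← mul_add, mul_left_comm c, mul_add c]
    gcongr
  have hV : 0 ≤ (∑ i ∈ Finset.univ.erase best, 1 / subopt gap i)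
      * ((M + 1 : ℕ) : ℝ) ^ (2 * α) := by positivity
  have hW0 : 0 ≤ blockBound α (subopt gap) best (M + 1) := by
    unfold blockBound
    positivity
  have hpb : 0 ≤ c * powerBound α (subopt gap) best T := by linarith
  constructor
  · refine (hreg K hK Ω P ℓ gap henv best hbest I p hrun T M hM hMT hTM).trans ?_
    calc C₁ * blockBound α (subopt gap) best (M + 1)
        ≤ (C₁ + C₂) * (c * powerBound α (subopt gap) best T) := by
          gcongr <;> linarith
      _ = _ := by ring
  · refine (hgen K hK (subopt gap) best hbest hle T M hM hMT hTM).trans ?_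
    calc _ ≤ (C₁ + C₂) * (c * powerBound α (subopt gap) best T) := by
          gcongr
          linarith
      _ = _ := by ring
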